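/- Let $s\ge 3$ be an integer. There is a constant $c_s>0$ depending only on $s$ with the following property. Let $h_n:\mathbb R^n\to\mathbb R$, $n\ge 1$, be a sequence of functions such that, for all $n\ge1$ and all arguments, (i) $h_{n+1}(\varepsilon_1,\dots,\varepsilon_j,0,\varepsilon_{j+1},\dots,\varepsilon_n)=h_n(\varepsilon_1,\dots,\varepsilon_n)$ for $0\le j\le n$; (ii) $\frac{\partial}{\partial\varepsilon_j}h_n(\varepsilon_1,\dots,\varepsilon_n)\big|_{\varepsilon_j=0}=0$ for $j=1,\dots,n$; (iii) $h_n(\varepsilon_{\pi(1)},\dots,\varepsilon_{\pi(n)})=h_n(\varepsilon_1,\dots,\varepsilon_n)$ for all $\pi\in S_n$. Call a multi-index admissible if its nonzero entries $\alpha_1,\dots,\alpha_r$ satisfy $1\le r\le s$, $\alpha_j\ge2$ for all $j$, and $\sum_{j=1}^r(\alpha_j-2)\le s-2$. Suppose that, for every $n\ge 1$, the partial derivatives $D^\beta h_n$ exist everywhere on $\mathbb R^n$ and do not depend on the order of differentiation, for all $\beta$ lying below an admissible multi-index, and that for some $B>0$ $$|D^\alpha h_n(\varepsilon_1,\dots,\varepsilon_n)|\le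 B\qquad\text{for all } n\ge 1,\ \varepsilon\in\mathbb R^n \text{ and all admissible }\alpha.$$ Then the limits $$h_\infty(\lambda_1,\dots,\lambda_l,\rho)=\lim_{k\to\infty}h_{l+k}\Big(\lambda_1,\dots,\lambda_l,\tfrac{\rho}{\sqrt k},\dots,\tfrac{\rho}{\sqrt k}\Big)$$ exist for all $l\ge0$ and all real $\lambda_1,\dots,\lambda_l,\rho$. Write $h_\infty(\lambda_1,\dots,\lambda_l)=h_\infty(\lambda_1,\dots,\lambda_l,1)$ and $h_\infty$ for the case $l=0$. For $1\le l\le s-3$ the partial derivatives $D^\beta h_\infty(\lambda_1,\dots,\lambda_l)$ with $\sum_j\max(\beta_j-2,0)\le l$ exist everywhere and do not depend on the order of differentiation. Moreover, for every $n$ and every $\varepsilon\in\mathbb R^n$ with $\sum_{i=1}^n\varepsilon_i^2=1$, $$h_n(\varepsilon_1,\dots,\varepsilon_n)=h_\infty+\sum_{l=1}^{s-3}P_l(\varepsilon^*\kappa_*)\,h_\infty(\lambda_1,\dots,\lambda_l)\big|_{\lambda_1=\dots=\lambda_l=0}+R_s,\qquad |R_s|\le c_s\,B\sum_{i=1}^n|\varepsilon_i|^s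 .$$ Here $\varepsilon^d=\sum_{i=1}^n\varepsilon_i^d$ denotes the power sums. The cumulant differential operators $\kappa_p=\kappa_p(D)$ are polynomials in formal commuting symbols $D^2,D^3,\dots$ given by the identity of formal power series in $t$ $$\sum_{p\ge2}\frac{t^p}{p!}\kappa_p(D)=\ln\Big(1+\sum_{p\ge2}\frac{t^p}{p!}D^p\Big),$$ and $$P_l(\varepsilon^*\kappa_*)=\sum_{m=1}^{l}\frac1{m!}\sum_{\substack{j_1,\dots,j_m\ge1\\ j_1+\dots+j_m=l}}\ \prod_{q=1}^m\frac{\varepsilon^{j_q+2}\,\kappa_{j_q+2}}{(j_q+2)!}.$$ Products of the symbols are formal (so $D^2D^2\ne D^4$): a monomial $D^{p_1}\cdots D^{p_m}$ acts as $\frac{\partial^{p_1}}{\partial\lambda_1^{p_1}}\cdots\frac{\partial^{p_m}}{\partial\lambda_m^{p_m}}$ (every monomial of $P_l$ has $m\le l$ factors), and the action is extended linearly. -/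

import Mathlib

namespace SymmExpansion

noncomputable section

/-- The first order partial derivative of `f` in the `i`-th variable. -/
def partialDeriv {n : ℕ} (i : Fin n) (f : (Fin n → ℝ) → ℝ) : (Fin n → ℝ) → ℝ :=
  fun x => deriv (fun t : ℝ => f (Function.update x i t)) (x i)

/-- `mixedPartial α f` is `D^α f`, the iterated partial derivative
`∂^{α₁}/∂x₁^{α₁} ⋯ ∂^{αₙ}/∂xₙ^{αₙ} f`. -/
def mixedPartial {n : ℕ} (α : Fin n → ℕ) (f : (Fin n → ℝ) → ℝ) : (Fin n → ℝ) → ℝ :=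
  (List.finRange n).foldr (fun i g => (partialDeriv i)^[α i] g) f

/-- The partial derivatives `D^β f`, `β ∈ A`, exist everywhere and do not depend on the order of
differentiation: whenever `β` and `β + eᵢ` lie in the set `A` of multi-indices, `D^β f` is
differentiable in the `i`-th variable, with derivative `D^{β+eᵢ} f`. (Here `A` is meant to be closed
under passing to smaller multi-indices; no continuity of the derivatives is required.) -/
def HasMixedPartials {n : ℕ} (A : Set (Fin n → ℕ)) (f : (Fin n → ℝ) → ℝ) : Prop :=
  ∀ (β : Fin n → ℕ) (i : Fin n), β ∈ A → β + Pi.single i 1 ∈ A → ∀ x : Fin n → ℝ,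
    HasDerivAt (fun t : ℝ => mixedPartial β f (Function.update x i t))
      (mixedPartial (β + Pi.single i 1) f x) (x i)

/-- The set of indices of variables in which `D^α` really differentiates. -/
def active {n : ℕ} (α : Fin n → ℕ) : Finset (Fin n) := Finset.univ.filter fun i => α i ≠ 0

/-- `α`, with its zero entries removed, is a vector `(α₁, …, α_r)` with `1 ≤ r ≤ s`, all
`α_j ≥ 2`, and `∑ (α_j - 2) ≤ s - 2` (the subtractions do not truncate when `2 ≤ s`). -/
def Admissible (s : ℕ) {n : ℕ} (α : Fin n → ℕ) : Prop :=
  α ≠ 0 ∧ (active α).card ≤ s ∧ (∀ i ∈ active α, 2 ≤ α i) ∧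
    ∑ i ∈ active α, (α i - 2) ≤ s - 2

/-- The multi-indices in at most `s` variables with `∑ max (β_j - 2, 0) ≤ s - 2`. If `n ≥ 1` and
`s ≥ 2`, these are exactly the multi-indices that lie below an admissible one. -/
def belowAdmissible (s n : ℕ) : Set (Fin n → ℕ) :=
  {β | (active β).card ≤ s ∧ ∑ i, (β i - 2) ≤ s - 2}

/-- Inserting a zero anywhere among the arguments of `h (n + 1)` gives `h n`. -/
def Consistent (h : (n : ℕ) → (Fin n → ℝ) → ℝ) : Prop :=
  ∀ n, 1 ≤ n → ∀ (j : Fin (n + 1)) (ε : Fin n → ℝ), h (n + 1) (j.insertNth 0 ε) = h n ε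

/-- The derivative of `h n` in its `j`-th variable exists and vanishes wherever that variable is
zero. -/
def VanishingDeriv (h : (n : ℕ) → (Fin n → ℝ) → ℝ) : Prop :=
  ∀ n, 1 ≤ n → ∀ (j : Fin n) (ε : Fin n → ℝ),
    HasDerivAt (fun t : ℝ => h n (Function.update ε j t)) 0 0

/-- Each `h n` is invariant under permutations of its arguments. -/
def Symmetric (h : (n : ℕ) → (Fin n → ℝ) → ℝ) : Prop :=
  ∀ n, 1 ≤ n → ∀ (π : Equiv.Perm (Fin n)) (ε : Fin n → ℝ), h n (fun i => ε (π i)) = h n ε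

/-- `H l (λ₁, …, λ_l) ρ` is the limit function `h_∞(λ₁, …, λ_l, ρ)`: the limit, as `k → ∞`, of
`h_{l+k}(λ₁, …, λ_l, ρ/√k, …, ρ/√k)`. -/
def IsLimitFunction (h : (n : ℕ) → (Fin n → ℝ) → ℝ)
    (H : (l : ℕ) → (Fin l → ℝ) → ℝ → ℝ) : Prop :=
  ∀ (l : ℕ) (lam : Fin l → ℝ) (ρ : ℝ),
    Filter.Tendsto
      (fun k : ℕ => h (l + k) (Fin.append lam (fun _ : Fin k => ρ / Real.sqrt (k : ℝ))))
      Filter.atTop (nhds (H l lam ρ))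

/-- Formal polynomials in the commuting symbols `D², D³, D⁴, …`; the variable `X p` stands for the
symbol `D^p`. The product of two symbols is a formal product (`D² D²` is not `D⁴`): different
factors differentiate in different variables, see `applyAtZero`. -/
abbrev DiffSymbols : Type := MvPolynomial ℕ ℝ

/-- The formal power series `∑_{p ≥ 2} D^p ε^p / p!`. -/
def symbolSeries : PowerSeries DiffSymbols :=
  PowerSeries.mk fun p =>
    if 2 ≤ p then MvPolynomial.C (1 / (p.factorial : ℝ)) * MvPolynomial.X p else 0

/-- The cumulant operators `κ_p(D)`, defined by the identity of formal power series
`∑_{p ≥ 2} κ_p(D) ε^p / p! = ln (1 + ∑_{p ≥ 2} D^p ε^p / p!)`. -/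
def cumulant (p : ℕ) : DiffSymbols :=
  MvPolynomial.C (p.factorial : ℝ) * PowerSeries.coeff p (PowerSeries.logOf (1 + symbolSeries))

/-- The Edgeworth polynomial `P_r(τ_* κ_*)`, `r ≥ 1`: the sum over `1 ≤ m ≤ r` and over the
`m`-tuples `j` of positive integers with sum `r` of
`(1 / m!) ∏_q τ_{j_q + 2} κ_{j_q + 2} / (j_q + 2)!`. -/
def edgeworth (r : ℕ) (τ : ℕ → ℝ) : DiffSymbols :=
  ∑ m ∈ Finset.Icc 1 r, MvPolynomial.C (1 / (m.factorial : ℝ)) *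
    ∑ j ∈ (Finset.Nat.antidiagonalTuple m r).filter (fun j => ∀ q, 1 ≤ j q),
      ∏ q : Fin m,
        (MvPolynomial.C (τ (j q + 2) / ((j q + 2).factorial : ℝ)) * cumulant (j q + 2))

/-- For a monomial `D^{p₁} ⋯ D^{p_m}` (given by its exponents `μ`), the multi-index
`(p₁, …, p_m, 0, …, 0)` of length `l`, where `p₁ ≥ p₂ ≥ ⋯`. (All monomials of `edgeworth l τ` have
`m ≤ l` factors.) -/
def orders (l : ℕ) (μ : ℕ →₀ ℕ) : Fin l → ℕ :=
  fun i => ((Finsupp.toMultiset μ).sort (fun a b => b ≤ a)).getD (i : ℕ) 0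

/-- Application of a polynomial in the symbols `D^p` to a function `f` of `λ₁, …, λ_l`, evaluated at
`λ = 0`: by linearity, where the monomial `D^{p₁} ⋯ D^{p_m}` gives
`∂^{p₁}/∂λ₁^{p₁} ⋯ ∂^{p_m}/∂λ_m^{p_m} f` at `λ = 0`. -/
def applyAtZero {l : ℕ} (Q : DiffSymbols) (f : (Fin l → ℝ) → ℝ) : ℝ :=
  ∑ μ ∈ Q.support, Q.coeff μ * mixedPartial (orders l μ) f 0

end

end SymmExpansion

/-!
The limit functions satisfy a heat equation in the variance `v = ρ²`: its derivative is half of the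
second derivative in a new argument at zero. Hence, formally, an argument `x` may be traded for the
variance `x²` at the price of the operator
`(1 + ∑ D^p x^p / p!) exp (-x² D² / 2) = exp (∑_{p ≥ 3} x^p κ_p / p!)`.
Trading all arguments multiplies these operators, power sums replace the powers of `x`, and the result
is the generating series of the Edgeworth polynomials. The proof makes this exact.

* The family `h` together with its derivatives is encoded as one function `F` of finite multisets of
  marks `(p, x)`, meaning "`p` derivatives, at the position `x`" (`MarkedFamily`,
  `markedFamily_ofMarks`). Symmetry becomes invisible, and consistency says that marks `(0, 0)` may be
  dropped.
* The hypotheses bound only derivatives of orders at least two. First derivatives vanish at zero, so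
  that they cost a factor `|x|` (`MarkedFamily.abs_le_weight`), and Taylor expansions have no linear
  term. Therefore a group of small arguments may be replaced by another one with the same sum of squares
  up to a third order error (Lindeberg's method, `MarkedFamily.abs_rescaled_sub_le`). This gives the
  limits (`MarkedFamily.tendsto_gaussLim`), their differentiability, and the heat equation
  (`MarkedFamily.hasDerivWithinAt_gaussLim_sqrt`).
* The formal identity above is `expSeries_cumulantSeries`, with truncations compared in
  `sum_coeff_edgeworthSeries_pow`. Monomials that contribute to the order `b` have at most `b` factors
  and excess at most `b` (`edgeworth_mem`), which keeps all the derivatives within the hypotheses.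
* Trading one argument has an error of order `|x| ^ (K + 2)` (`MarkedFamily.abs_gaussEval_swap_le`). An
  induction on the length of the expansion and on the set of traded arguments
  (`exists_expansion_bound`) adds up the errors. Products of power sums which appear there are bounded
  by Chebyshev's inequality (`sum_abs_pow_mul_le`), as `∑ εᵢ² = 1`.
-/

namespace SymmExpansion

open Filter Topology

/-! ### Marked point configurations -/

/-- The number of marks that carry a genuine derivative. -/
def activeCard (m : Multiset (ℕ × ℝ)) : ℕ := m.countP fun q => q.1 ≠ 0

/-- The total derivative order in excess of two per mark, `∑ max (p - 2, 0)`. -/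
def excess (m : Multiset (ℕ × ℝ)) : ℕ := (m.map fun q => q.1 - 2).sum

/-- The product of `|t|` over the marks `(1, t)`. Since first derivatives vanish at zero, this is the
factor by which first order marks enter the bounds. -/
noncomputable def weight (m : Multiset (ℕ × ℝ)) : ℝ :=
  (m.map fun q => if q.1 = 1 then |q.2| else 1).prod

/-- Marks without derivatives: plain arguments. -/
def points (X : Multiset ℝ) : Multiset (ℕ × ℝ) := X.map fun x => (0, x)

@[simp] lemma activeCard_zero : activeCard 0 = 0 := rfl

@[simp] lemma activeCard_cons (q : ℕ × ℝ) (m : Multiset (ℕ × ℝ)) :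
    activeCard (q ::ₘ m) = activeCard m + if q.1 = 0 then 0 else 1 := by
  by_cases h : q.1 = 0 <;> simp [activeCard, h]

@[simp] lemma activeCard_add (m m' : Multiset (ℕ × ℝ)) :
    activeCard (m + m') = activeCard m + activeCard m' := by
  simp [activeCard]

@[simp] lemma activeCard_points (X : Multiset ℝ) : activeCard (points X) = 0 := by
  simp [activeCard, points, Multiset.countP_eq_zero]

@[simp] lemma excess_zero : excess 0 = 0 := rfl

@[simp] lemma excess_cons (q : ℕ × ℝ) (m : Multiset (ℕ × ℝ)) :
    excess (q ::ₘ m) = excess m + (q.1 - 2) := by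
  simp [excess, add_comm]

@[simp] lemma excess_add (m m' : Multiset (ℕ × ℝ)) :
    excess (m + m') = excess m + excess m' := by
  simp [excess]

@[simp] lemma excess_points (X : Multiset ℝ) : excess (points X) = 0 := by
  simp [excess, points]

@[simp] lemma weight_zero : weight 0 = 1 := by simp [weight]

@[simp] lemma weight_cons (q : ℕ × ℝ) (m : Multiset (ℕ × ℝ)) :
    weight (q ::ₘ m) = (if q.1 = 1 then |q.2| else 1) * weight m := by
  simp [weight]

@[simp] lemma weight_add (m m' : Multiset (ℕ × ℝ)) :
    weight (m + m') = weight m * weight m' := by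
  simp [weight]

@[simp] lemma weight_points (X : Multiset ℝ) : weight (points X) = 1 := by
  simp [weight, points]

lemma weight_nonneg (m : Multiset (ℕ × ℝ)) : 0 ≤ weight m := by
  induction m using Multiset.induction with
  | empty => simp
  | cons q m ih => rw [weight_cons]; split_ifs <;> positivity

@[simp] lemma points_zero : points 0 = 0 := rfl

@[simp] lemma points_cons (x : ℝ) (X : Multiset ℝ) : points (x ::ₘ X) = (0, x) ::ₘ points X := by
  simp [points]

@[simp] lemma points_add (X Y : Multiset ℝ) : points (X + Y) = points X + points Y := by
  simp [points]

lemma sum_sq_nonneg (X : Multiset ℝ) : 0 ≤ (X.map (· ^ 2)).sum :=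
  Multiset.sum_nonneg fun x hx => by
    obtain ⟨y, -, rfl⟩ := Multiset.mem_map.1 hx
    positivity

/-- A symmetric, consistent family of functions together with its partial derivatives, encoded as one
function of finite configurations of marks: `F {(β₁, x₁), …, (βₙ, xₙ)}` stands for
`D^β h_n (x₁, …, xₙ)`. The inequalities say that the derivatives in question lie below an admissible
multi-index. -/
structure MarkedFamily (s : ℕ) (B : ℝ) (F : Multiset (ℕ × ℝ) → ℝ) : Prop where
  zero_mark : ∀ m, activeCard m ≤ s → excess m ≤ s - 2 → F ((0, 0) ::ₘ m) = F m
  hasDerivAt : ∀ p t m, activeCard m + 1 ≤ s → excess m + (p + 1 - 2) ≤ s - 2 →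
    HasDerivAt (fun u => F ((p, u) ::ₘ m)) (F ((p + 1, t) ::ₘ m)) t
  one_mark : ∀ m, activeCard m + 1 ≤ s → excess m ≤ s - 2 → F ((1, 0) ::ₘ m) = 0
  bound : ∀ m, activeCard m ≤ s → excess m ≤ s - 2 → (∀ q ∈ m, q.1 ≠ 1) → (∃ q ∈ m, q.1 ≠ 0) →
    |F m| ≤ B

/-! ### Taylor expansions in one mark -/

/-- Taylor's formula on a convex set, when the last derivative is only known to be Lipschitz at the
base point. -/
lemma taylor_convex {S : Set ℝ} (hS : Convex ℝ S) {a C : ℝ} (ha : a ∈ S) (hC : 0 ≤ C) (P : ℕ) :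
    ∀ f : ℕ → ℝ → ℝ,
      (∀ j < P, ∀ x ∈ S, HasDerivWithinAt (f j) (f (j + 1) x) S x) →
      (∀ x ∈ S, |f P x - f P a| ≤ C * |x - a|) →
      ∀ x ∈ S, |f 0 x - ∑ p ∈ Finset.range (P + 1), (x - a) ^ p / p.factorial * f p a|
        ≤ C * |x - a| ^ (P + 1) := by
  induction P with
  | zero => intro f _ hL x hx; simpa using hL x hx
  | succ P ih =>
    intro f hd hL x hx
    have key := ih (fun j => f (j + 1)) (fun j hj => hd (j + 1) (by omega)) hL
    set R : ℝ → ℝ := fun y => f 0 y -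
      ∑ p ∈ Finset.range (P + 1 + 1), (y - a) ^ p / p.factorial * f p a with hR
    set R' : ℝ → ℝ := fun y => f 1 y -
      ∑ p ∈ Finset.range (P + 1), (y - a) ^ p / p.factorial * f (p + 1) a with hR'
    have hsub : segment ℝ a x ⊆ S := hS.segment_subset ha hx
    have hder : ∀ y ∈ segment ℝ a x, HasDerivWithinAt R (R' y) (segment ℝ a x) y := by
      intro y hy
      refine ((hd 0 (by omega) y (hsub hy)).mono hsub).sub ?_
      have h1 : ∀ p : ℕ, HasDerivAt (fun y : ℝ => (y - a) ^ (p + 1) / (p + 1).factorial * f (p + 1) a)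
          ((y - a) ^ p / p.factorial * f (p + 1) a) y := by
        intro p
        have := ((((hasDerivAt_id y).sub_const a).pow (p + 1)).div_const
          ((p + 1).factorial : ℝ)).mul_const (f (p + 1) a)
        refine this.congr_deriv ?_
        have h3 : (p.factorial : ℝ) ≠ 0 := by positivity
        simp only [id, Nat.factorial_succ]
        push_cast
        field_simp
      have h2 := HasDerivAt.fun_sum (u := Finset.range (P + 1)) fun p _ => h1 p
      have h3 := (h2.add_const (f 0 a)).hasDerivWithinAt (s := segment ℝ a x)
      refine h3.congr_of_mem ?_ hy
      intro z _
      rw [Finset.sum_range_succ']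
      simp
    have hle : ∀ y ∈ segment ℝ a x, |y - a| ≤ |x - a| := by
      intro y hy
      rw [segment_eq_uIcc] at hy
      exact Set.abs_sub_left_of_mem_uIcc hy
    have hb : ∀ y ∈ segment ℝ a x, ‖R' y‖ ≤ C * |x - a| ^ (P + 1) := by
      intro y hy
      refine (key y (hsub hy)).trans ?_
      have := hle y hy
      gcongr
    have hmv := (convex_segment a x).norm_image_sub_le_of_norm_hasDerivWithin_le hder hb
      (left_mem_segment ℝ a x) (right_mem_segment ℝ a x)
    have hRa : R a = 0 := by
      simp only [hR]
      rw [Finset.sum_range_succ']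
      simp
    rw [hRa, sub_zero, Real.norm_eq_abs, Real.norm_eq_abs, mul_assoc, ← pow_succ] at hmv
    exact hmv

namespace MarkedFamily

variable {s : ℕ} {B : ℝ} {F : Multiset (ℕ × ℝ) → ℝ}

/-- First order marks may be integrated away, at the cost of a factor `|t|` each. -/
lemma abs_le_weight (hF : MarkedFamily s B F) (m : Multiset (ℕ × ℝ))
    (hc : activeCard m ≤ s) (he : excess m ≤ s - 2) (hm : ∃ q ∈ m, q.1 ≠ 0) :
    |F m| ≤ B * weight m := by
  induction hk : m.countP (fun q => q.1 = 1) generalizing m with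
  | zero =>
    have h1 : ∀ q ∈ m, q.1 ≠ 1 := Multiset.countP_eq_zero.1 hk
    have hw : weight m = 1 := by
      refine Multiset.prod_eq_one fun x hx => ?_
      obtain ⟨q, hq, rfl⟩ := Multiset.mem_map.1 hx
      simp [h1 q hq]
    rw [hw, mul_one]
    exact hF.bound m hc he h1 hm
  | succ k ih =>
    obtain ⟨⟨p, t⟩, hq, hp⟩ : ∃ q ∈ m, q.1 = 1 := Multiset.countP_pos.1 (by omega)
    obtain ⟨m, rfl⟩ := Multiset.exists_cons_of_mem hq
    simp only at hp
    subst hp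
    simp only [activeCard_cons, excess_cons, one_ne_zero, if_false] at hc he
    have hd : ∀ u ∈ (Set.univ : Set ℝ), HasDerivWithinAt (fun u => F ((1, u) ::ₘ m))
        (F ((2, u) ::ₘ m)) Set.univ u :=
      fun u _ => (hF.hasDerivAt 1 u m hc (by omega)).hasDerivWithinAt
    have hb : ∀ u ∈ (Set.univ : Set ℝ), ‖F ((2, u) ::ₘ m)‖ ≤ B * weight m := by
      intro u _
      have := ih ((2, u) ::ₘ m) (by simpa using hc) (by simpa using he)
        ⟨(2, u), by simp, by simp⟩ (by simpa using hk)
      simpa using this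
    have := convex_univ.norm_image_sub_le_of_norm_hasDerivWithin_le hd hb
      (Set.mem_univ 0) (Set.mem_univ t)
    rw [hF.one_mark m hc (by omega)] at this
    simp only [sub_zero, Real.norm_eq_abs] at this
    refine this.trans (le_of_eq ?_)
    simp
    ring

/-- Taylor expansion in one mark. The order `P` starts at two, because only derivatives of order at
least two are bounded. -/
lemma taylor_mark (hF : MarkedFamily s B F) (hB : 0 ≤ B) (q P : ℕ) (a t : ℝ)
    (m : Multiset (ℕ × ℝ)) (hc : activeCard m + 1 ≤ s)
    (he : excess m + (q + P) ≤ s - 2) :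
    |F ((q, t) ::ₘ m) - ∑ p ∈ Finset.range (P + 2),
        (t - a) ^ p / p.factorial * F ((q + p, a) ::ₘ m)| ≤ B * weight m * |t - a| ^ (P + 2) := by
  have hw := weight_nonneg m
  have := taylor_convex convex_univ (Set.mem_univ a) (C := B * weight m) (by positivity)
    (P + 1) (fun j u => F ((q + j, u) ::ₘ m))
    (fun j hj u _ => (hF.hasDerivAt (q + j) u m hc (by omega)).hasDerivWithinAt) ?_ t (Set.mem_univ t)
  · simpa using this
  · intro x _
    refine convex_univ.norm_image_sub_le_of_norm_hasDerivWithin_le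
      (f' := fun u => F ((q + (P + 2), u) ::ₘ m))
      (fun u _ => (hF.hasDerivAt (q + (P + 1)) u m hc (by omega)).hasDerivWithinAt) ?_
      (Set.mem_univ a) (Set.mem_univ x)
    intro u _
    have := hF.abs_le_weight ((q + (P + 2), u) ::ₘ m)
      (by simpa using hc) (by simp only [excess_cons]; omega) ⟨_, Multiset.mem_cons_self _ _, by simp⟩
    simpa [show q + (P + 2) ≠ 1 by omega] using this

lemma abs_add_point_sub_le (hF : MarkedFamily s B F) (hB : 0 ≤ B) (t : ℝ)
    (m : Multiset (ℕ × ℝ)) (hc : activeCard m + 1 ≤ s) (he : excess m ≤ s - 2) :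
    |F ((0, t) ::ₘ m) - F m| ≤ B * weight m * t ^ 2 := by
  have := hF.taylor_mark hB 0 0 0 t m hc (by simpa using he)
  simpa [Finset.sum_range_succ, hF.zero_mark m (by omega) he, hF.one_mark m hc he] using this

lemma abs_add_point_sub_sub_le (hF : MarkedFamily s B F) (hB : 0 ≤ B) (t : ℝ)
    (m : Multiset (ℕ × ℝ)) (hc : activeCard m + 1 ≤ s) (he : excess m + 1 ≤ s - 2) :
    |F ((0, t) ::ₘ m) - F m - t ^ 2 / 2 * F ((2, 0) ::ₘ m)| ≤ B * weight m * |t| ^ 3 := by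
  have := hF.taylor_mark hB 0 1 0 t m hc (by simpa using he)
  simpa [Finset.sum_range_succ, hF.zero_mark m (by omega) (by omega),
    hF.one_mark m hc (by omega), sub_sub] using this

/-! ### Lindeberg replacement -/

lemma abs_add_points_sub_le (hF : MarkedFamily s B F) (hB : 0 ≤ B) (X : Multiset ℝ)
    (m : Multiset (ℕ × ℝ)) (hc : activeCard m + 1 ≤ s) (he : excess m ≤ s - 2) :
    |F (points X + m) - F m| ≤ B * weight m * (X.map (· ^ 2)).sum := by
  induction X using Multiset.induction with
  | empty => simp
  | cons x X ih =>
    have := hF.abs_add_point_sub_le hB x (points X + m) (by simpa using hc) (by simpa using he)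
    simp only [weight_add, weight_points, one_mul] at this
    simp only [points_cons, Multiset.cons_add, Multiset.map_cons, Multiset.sum_cons]
    rw [abs_le] at *
    constructor <;> nlinarith

lemma abs_add_points_sub_sub_le (hF : MarkedFamily s B F) (hB : 0 ≤ B) (X : Multiset ℝ)
    (m : Multiset (ℕ × ℝ)) (hc : activeCard m + 2 ≤ s) (he : excess m + 1 ≤ s - 2) :
    |F (points X + m) - F m - (X.map (· ^ 2)).sum / 2 * F ((2, 0) ::ₘ m)| ≤
      B * weight m * ((X.map (|·| ^ 3)).sum + (X.map (· ^ 2)).sum ^ 2) := by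
  induction X using Multiset.induction with
  | empty => simp
  | cons x X ih =>
    have h1 := hF.abs_add_point_sub_sub_le hB x (points X + m) (by simp; omega) (by simpa using he)
    have h2 := hF.abs_add_points_sub_le hB X ((2, 0) ::ₘ m) (by simp; omega)
      (by simp; omega)
    simp only [weight_add, weight_points, one_mul, weight_cons, OfNat.ofNat_ne_one, if_false] at h1 h2
    simp only [points_cons, Multiset.cons_add, Multiset.map_cons, Multiset.sum_cons]
    rw [Multiset.add_cons] at h2
    have hV := sum_sq_nonneg X
    set V := (X.map (· ^ 2)).sum
    have hw := mul_nonneg hB (weight_nonneg m)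
    set W := B * weight m
    have h3 : |x ^ 2 / 2 * (F ((2, 0) ::ₘ (points X + m)) - F ((2, 0) ::ₘ m))| ≤ x ^ 2 / 2 * (W * V) := by
      rw [abs_mul, abs_of_nonneg (by positivity : 0 ≤ x ^ 2 / 2)]
      gcongr
    have h4 : 0 ≤ W * (x ^ 2) ^ 2 := by positivity
    have h5 : 0 ≤ W * (x ^ 2 * V) := by positivity
    rw [abs_le] at *
    constructor <;> nlinarith

/-- Lindeberg replacement: two groups of arguments with the same sum of squares are interchangeable
up to third order terms. -/
lemma abs_points_sub_points_le (hF : MarkedFamily s B F) (hB : 0 ≤ B) {X Y : Multiset ℝ}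
    (hXY : (X.map (· ^ 2)).sum = (Y.map (· ^ 2)).sum)
    (m : Multiset (ℕ × ℝ)) (hc : activeCard m + 2 ≤ s) (he : excess m + 1 ≤ s - 2) :
    |F (points X + m) - F (points Y + m)| ≤ B * weight m * ((X.map (|·| ^ 3)).sum +
      (Y.map (|·| ^ 3)).sum + 2 * (X.map (· ^ 2)).sum ^ 2) := by
  have h1 := hF.abs_add_points_sub_sub_le hB X m hc he
  have h2 := hF.abs_add_points_sub_sub_le hB Y m hc he
  rw [← hXY] at h2
  rw [abs_le] at *
  constructor <;> linarith

lemma abs_nsmul_points_sub_le (hF : MarkedFamily s B F) (hB : 0 ≤ B) {X Y : Multiset ℝ}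
    (hXY : (X.map (· ^ 2)).sum = (Y.map (· ^ 2)).sum) (k : ℕ)
    (m : Multiset (ℕ × ℝ)) (hc : activeCard m + 2 ≤ s) (he : excess m + 1 ≤ s - 2) :
    |F (points (k • X) + m) - F (points (k • Y) + m)| ≤ k * (B * weight m * ((X.map (|·| ^ 3)).sum +
      (Y.map (|·| ^ 3)).sum + 2 * (X.map (· ^ 2)).sum ^ 2)) := by
  induction k generalizing m with
  | zero => simp
  | succ k ih =>
    have h1 := hF.abs_points_sub_points_le hB hXY (points (k • X) + m) (by simpa using hc)
      (by simpa using he)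
    have h2 := ih (points Y + m) (by simpa using hc) (by simpa using he)
    simp only [weight_add, weight_points, one_mul] at h1 h2
    rw [show points Y + (points (k • X) + m) = points (k • X) + (points Y + m) by abel] at h1
    have e : ∀ Z : Multiset ℝ, points ((k + 1) • Z) + m = points Z + (points (k • Z) + m) := by
      intro Z; rw [add_smul, one_smul, points_add]; abel
    rw [e X, e Y, show points Y + (points (k • Y) + m) = points (k • Y) + (points Y + m) by abel]
    push_cast
    rw [abs_le] at *
    constructor <;> nlinarith

end MarkedFamily

/-! ### The Gaussian limit -/

/-- The limit of `F` along `k` additional arguments `ρ / √k`, as `k → ∞`. -/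
noncomputable def gaussLim (F : Multiset (ℕ × ℝ) → ℝ) (ρ : ℝ) (m : Multiset (ℕ × ℝ)) : ℝ :=
  limUnder atTop fun k : ℕ => F (points (Multiset.replicate k (ρ / √(k : ℝ))) + m)

lemma tendsto_const_div_sqrt (C : ℝ) : Tendsto (fun k : ℕ => C / √(k : ℝ)) atTop (𝓝 0) :=
  (Real.tendsto_sqrt_atTop.comp tendsto_natCast_atTop_atTop).const_div_atTop C

/-- A function with a quadratic first order remainder is differentiable. -/
lemma hasDerivWithinAt_of_abs_sub_le {f : ℝ → ℝ} {f' a C : ℝ} {S : Set ℝ}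
    (h : ∀ x ∈ S, |f x - f a - (x - a) * f'| ≤ C * (x - a) ^ 2) : HasDerivWithinAt f f' S a := by
  rw [hasDerivWithinAt_iff_isLittleO]
  have h1 : (fun x => f x - f a - (x - a) • f') =O[𝓝[S] a] fun x => (x - a) ^ 2 := by
    refine Asymptotics.IsBigO.of_bound C ?_
    filter_upwards [self_mem_nhdsWithin] with x hx
    simpa [Real.norm_eq_abs] using h x hx
  refine h1.trans_isLittleO ?_
  have h2 : (fun x : ℝ => (x - a) ^ 2) =o[𝓝 a] fun x => x - a := by
    have h3 : Tendsto (fun x : ℝ => x - a) (𝓝 a) (𝓝 0) :=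
      (continuous_sub_right a).tendsto' a 0 (sub_self a)
    exact (Asymptotics.isLittleO_pow_id one_lt_two).comp_tendsto h3
  exact h2.mono nhdsWithin_le_nhds

namespace MarkedFamily

variable {s : ℕ} {B : ℝ} {F : Multiset (ℕ × ℝ) → ℝ}

/-- `k` copies of a fixed group of arguments, rescaled by `1 / √k`, may be replaced by `k` copies of
another one with the same sum of squares; the error is `O(1 / √k)`. -/
lemma abs_rescaled_sub_le (hF : MarkedFamily s B F) (hB : 0 ≤ B) {X Y : Multiset ℝ}
    (hXY : (X.map (· ^ 2)).sum = (Y.map (· ^ 2)).sum) {k : ℕ} (hk : 1 ≤ k)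
    (m : Multiset (ℕ × ℝ)) (hc : activeCard m + 2 ≤ s) (he : excess m + 1 ≤ s - 2) :
    |F (points (k • X.map (· / √(k : ℝ))) + m) - F (points (k • Y.map (· / √(k : ℝ))) + m)| ≤
      B * weight m * ((X.map (|·| ^ 3)).sum + (Y.map (|·| ^ 3)).sum
        + 2 * (X.map (· ^ 2)).sum ^ 2) / √(k : ℝ) := by
  set r := √(k : ℝ) with hr
  have hr1 : 1 ≤ r := Real.one_le_sqrt.2 (by exact_mod_cast hk)
  have hr2 : (k : ℝ) = r ^ 2 := (Real.sq_sqrt (by positivity)).symm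
  have h2 : ∀ Z : Multiset ℝ, ((Z.map (· / r)).map (· ^ 2)).sum = (Z.map (· ^ 2)).sum / r ^ 2 := by
    intro Z
    rw [Multiset.map_map, ← Multiset.sum_map_div]
    simp [div_pow]
  have h3 : ∀ Z : Multiset ℝ, ((Z.map (· / r)).map (|·| ^ 3)).sum
      = (Z.map (|·| ^ 3)).sum / r ^ 3 := by
    intro Z
    rw [Multiset.map_map, ← Multiset.sum_map_div]
    simp [div_pow, abs_div, abs_of_nonneg (zero_le_one.trans hr1)]
  have key := hF.abs_nsmul_points_sub_le hB (X := X.map (· / r)) (Y := Y.map (· / r))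
    (by rw [h2, h2, hXY]) k m hc he
  refine key.trans ?_
  rw [h2, h3, h3, hr2]
  have hw := mul_nonneg hB (weight_nonneg m)
  set W := B * weight m
  set x := (X.map (|·| ^ 3)).sum
  set y := (Y.map (|·| ^ 3)).sum
  set V := (X.map (· ^ 2)).sum
  have e : r ^ 2 * (W * (x / r ^ 3 + y / r ^ 3 + 2 * (V / r ^ 2) ^ 2))
      = W * (x + y + 2 * V ^ 2 / r) / r := by
    field_simp
  rw [e]
  gcongr
  exact div_le_self (by positivity) hr1

lemma tendsto_gaussLim (hF : MarkedFamily s B F) (hB : 0 ≤ B) (ρ : ℝ)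
    (m : Multiset (ℕ × ℝ)) (hc : activeCard m + 2 ≤ s) (he : excess m + 1 ≤ s - 2) :
    Tendsto (fun k : ℕ => F (points (Multiset.replicate k (ρ / √(k : ℝ))) + m)) atTop
      (𝓝 (gaussLim F ρ m)) := by
  refine CauchySeq.tendsto_limUnder ?_
  set u : ℕ → ℝ := fun k : ℕ => F (points (Multiset.replicate k (ρ / √(k : ℝ))) + m) with hu
  set C := B * weight m * (|ρ| ^ 3 + |ρ| ^ 3 + 2 * (ρ ^ 2) ^ 2) with hC
  -- Every `ρ / √k` may be split further into `N` equal parts.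
  have key : ∀ k N : ℕ, 1 ≤ k → 1 ≤ N → |u k - u (k * N)| ≤ C / √(k : ℝ) := by
    intro k N hk hN
    have hN1 : (1 : ℝ) ≤ N := by exact_mod_cast hN
    have hN2 : (N : ℝ) = √(N : ℝ) ^ 2 := (Real.sq_sqrt (by positivity)).symm
    have hN3 : 1 ≤ √(N : ℝ) := Real.one_le_sqrt.2 hN1
    have h := hF.abs_rescaled_sub_le hB (X := {ρ}) (Y := Multiset.replicate N (ρ / √(N : ℝ)))
      (by
        simp only [Multiset.map_singleton, Multiset.sum_singleton, Multiset.map_replicate,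
          Multiset.sum_replicate, nsmul_eq_mul, div_pow]
        rw [← hN2]; field_simp) hk m hc he
    have e1 : k • Multiset.map (· / √(k : ℝ)) {ρ} = Multiset.replicate k (ρ / √(k : ℝ)) := by
      simp [Multiset.nsmul_singleton]
    have e2 : k • Multiset.map (· / √(k : ℝ)) (Multiset.replicate N (ρ / √(N : ℝ)))
        = Multiset.replicate (k * N) (ρ / √((k * N : ℕ) : ℝ)) := by
      rw [Multiset.map_replicate, Multiset.nsmul_replicate]
      congr 1
      rw [Nat.cast_mul, Real.sqrt_mul (by positivity), div_div, mul_comm]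
    rw [e1, e2] at h
    refine h.trans ?_
    have hw := mul_nonneg hB (weight_nonneg m)
    rw [hC]
    simp only [Multiset.map_singleton, Multiset.sum_singleton, Multiset.map_replicate,
          Multiset.sum_replicate, nsmul_eq_mul, abs_div, div_pow]
    gcongr
    rw [abs_of_nonneg (zero_le_one.trans hN3), mul_div_left_comm]
    nth_rw 1 [hN2]
    refine mul_le_of_le_one_right (by positivity) ?_
    exact div_le_one_of_le₀ (pow_le_pow_right₀ hN3 (by norm_num)) (by positivity)
  rw [Metric.cauchySeq_iff]
  intro ε hε
  have h0 := (tendsto_const_div_sqrt C).eventually (gt_mem_nhds (half_pos hε))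
  obtain ⟨N, hN⟩ := (h0.and (eventually_ge_atTop 1)).exists_forall_of_atTop
  refine ⟨N, fun i hi j hj => ?_⟩
  have h1 := key i j (hN i hi).2 (hN j hj).2
  have h2 := key j i (hN j hj).2 (hN i hi).2
  rw [mul_comm j i] at h2
  have h3 := (hN i hi).1
  have h4 := (hN j hj).1
  rw [Real.dist_eq]
  rw [abs_le] at h1 h2
  rw [abs_lt]
  constructor <;> linarith

/-- A bound on `F` that is uniform in the additional arguments passes to the limit. -/
lemma abs_gaussLim_le (hF : MarkedFamily s B F) (hB : 0 ≤ B) (ρ : ℝ)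
    (m : Multiset (ℕ × ℝ)) (hc : activeCard m + 2 ≤ s) (he : excess m + 1 ≤ s - 2)
    (hm : ∃ q ∈ m, q.1 ≠ 0) : |gaussLim F ρ m| ≤ B * weight m := by
  refine le_of_tendsto (hF.tendsto_gaussLim hB ρ m hc he).abs (Eventually.of_forall fun k => ?_)
  obtain ⟨q, hq, hq0⟩ := hm
  have := hF.abs_le_weight (points (Multiset.replicate k (ρ / √(k : ℝ))) + m) (by simp; omega)
    (by simp; omega) ⟨q, by simp [hq], hq0⟩
  simpa using this

lemma gaussLim_zero_mark (hF : MarkedFamily s B F) (ρ : ℝ)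
    (m : Multiset (ℕ × ℝ)) (hc : activeCard m ≤ s) (he : excess m ≤ s - 2) :
    gaussLim F ρ ((0, 0) ::ₘ m) = gaussLim F ρ m := by
  unfold gaussLim
  congr 1
  funext k
  rw [Multiset.add_cons, hF.zero_mark _ (by simpa using hc) (by simpa using he)]

lemma gaussLim_one_mark (hF : MarkedFamily s B F) (ρ : ℝ)
    (m : Multiset (ℕ × ℝ)) (hc : activeCard m + 1 ≤ s) (he : excess m ≤ s - 2) :
    gaussLim F ρ ((1, 0) ::ₘ m) = 0 := by
  unfold gaussLim
  simp_rw [Multiset.add_cons]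
  have : ∀ k : ℕ, F ((1, 0) ::ₘ (points (Multiset.replicate k (ρ / √(k : ℝ))) + m)) = 0 :=
    fun k => hF.one_mark _ (by simpa using hc) (by simpa using he)
  simp_rw [this]
  exact tendsto_const_nhds.limUnder_eq

/-- With `ρ = 0` all additional arguments vanish. -/
lemma gaussLim_zero (hF : MarkedFamily s B F) (m : Multiset (ℕ × ℝ)) (hc : activeCard m ≤ s)
    (he : excess m ≤ s - 2) : gaussLim F 0 m = F m := by
  unfold gaussLim
  have : ∀ k : ℕ, F (points (Multiset.replicate k (0 / √(k : ℝ))) + m) = F m := by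
    intro k
    rw [zero_div]
    induction k with
    | zero => simp
    | succ k ih =>
      rw [Multiset.replicate_succ, points_cons, Multiset.cons_add,
        hF.zero_mark _ (by simpa using hc) (by simpa using he), ih]
  simp_rw [this]
  exact tendsto_const_nhds.limUnder_eq

lemma abs_gaussLim_taylor_le (hF : MarkedFamily s B F) (hB : 0 ≤ B) (ρ : ℝ) (q P : ℕ) (a t : ℝ)
    (m : Multiset (ℕ × ℝ)) (hc : activeCard m + 3 ≤ s) (he : excess m + 1 ≤ s - 2)
    (he' : excess m + (q + P) ≤ s - 2) :
    |gaussLim F ρ ((q, t) ::ₘ m) - ∑ p ∈ Finset.range (P + 2),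
        (t - a) ^ p / p.factorial * gaussLim F ρ ((q + p, a) ::ₘ m)|
      ≤ B * weight m * |t - a| ^ (P + 2) := by
  have hc' : ∀ p x, activeCard ((p, x) ::ₘ m) + 2 ≤ s := by
    intro p x; simp only [activeCard_cons]; split_ifs <;> omega
  have hx : ∀ p x, p < q + P + 2 → excess ((p, x) ::ₘ m) + 1 ≤ s - 2 := by
    intro p x hp; simp only [excess_cons]; omega
  have h1 := hF.tendsto_gaussLim hB ρ ((q, t) ::ₘ m) (hc' _ _) (hx _ _ (by omega))
  have h2 := tendsto_finsetSum (Finset.range (P + 2)) fun p hp =>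
    (hF.tendsto_gaussLim hB ρ ((q + p, a) ::ₘ m) (hc' _ _)
      (hx _ _ (by rw [Finset.mem_range] at hp; omega))).const_mul ((t - a) ^ p / p.factorial)
  refine le_of_tendsto (h1.sub h2).abs (Eventually.of_forall fun k => ?_)
  have := hF.taylor_mark hB q P a t (points (Multiset.replicate k (ρ / √(k : ℝ))) + m)
    (by simp; omega) (by simpa using he')
  simpa only [Multiset.add_cons, weight_add, weight_points, one_mul] using this

/-- Derivatives commute with the limit. Pointwise convergence is enough, since the Taylor remainders are
bounded uniformly in the number of additional arguments. -/
lemma hasDerivAt_gaussLim (hF : MarkedFamily s B F) (hB : 0 ≤ B) (ρ : ℝ) (p : ℕ) (t : ℝ)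
    (m : Multiset (ℕ × ℝ)) (hc : activeCard m + 3 ≤ s) (he : excess m + (p + 1 - 2) + 1 ≤ s - 2) :
    HasDerivAt (fun u => gaussLim F ρ ((p, u) ::ₘ m)) (gaussLim F ρ ((p + 1, t) ::ₘ m)) t := by
  rw [← hasDerivWithinAt_univ]
  refine hasDerivWithinAt_of_abs_sub_le (C := B * weight m) fun x _ => ?_
  have := hF.abs_gaussLim_taylor_le hB ρ p 0 t x m hc (by omega) (by omega)
  simpa [Finset.sum_range_succ, sub_sub] using this

/-! ### The heat equation -/

/-- Independent Gaussian limits add their variances: `k` arguments `√((v + u) / k)` may be replaced by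
`k` arguments `√(u / k)` and `k` arguments `√(v / k)`. -/
lemma tendsto_split_variance (hF : MarkedFamily s B F) (hB : 0 ≤ B) {u v : ℝ} (hu : 0 ≤ u)
    (hv : 0 ≤ v) (m : Multiset (ℕ × ℝ)) (hc : activeCard m + 2 ≤ s) (he : excess m + 1 ≤ s - 2) :
    Tendsto (fun k : ℕ => F (points (Multiset.replicate k (√u / √(k : ℝ))) +
      (points (Multiset.replicate k (√v / √(k : ℝ))) + m))) atTop (𝓝 (gaussLim F √(v + u) m)) := by
  have h1 := hF.tendsto_gaussLim hB √(v + u) m hc he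
  refine h1.congr_dist (squeeze_zero' (Eventually.of_forall fun _ => dist_nonneg) ?_
    (tendsto_const_div_sqrt (B * weight m * ((({√(v + u)} : Multiset ℝ).map (|·| ^ 3)).sum
      + (({√u, √v} : Multiset ℝ).map (|·| ^ 3)).sum
      + 2 * (({√(v + u)} : Multiset ℝ).map (· ^ 2)).sum ^ 2))))
  filter_upwards [eventually_ge_atTop 1] with k hk
  have h := hF.abs_rescaled_sub_le hB (X := {√(v + u)}) (Y := {√u, √v})
      (by simp [Real.sq_sqrt, hu, hv, add_nonneg, add_comm]) hk m hc he
  have e1 : k • Multiset.map (· / √(k : ℝ)) {√(v + u)}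
      = Multiset.replicate k (√(v + u) / √(k : ℝ)) := by
    simp [Multiset.nsmul_singleton]
  have e2 : k • Multiset.map (· / √(k : ℝ)) {√u, √v}
      = Multiset.replicate k (√u / √(k : ℝ)) + Multiset.replicate k (√v / √(k : ℝ)) := by
    rw [← Multiset.nsmul_singleton, ← Multiset.nsmul_singleton, ← nsmul_add]
    simp
  rw [e1, e2, points_add, add_assoc] at h
  exact h

lemma abs_gaussLim_sub_le (hF : MarkedFamily s B F) (hB : 0 ≤ B) {u v : ℝ} (hu : 0 ≤ u)
    (hv : 0 ≤ v) (m : Multiset (ℕ × ℝ)) (hc : activeCard m + 2 ≤ s) (he : excess m + 1 ≤ s - 2) :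
    |gaussLim F √(v + u) m - gaussLim F √v m| ≤ B * weight m * u := by
  have h1 := hF.tendsto_split_variance hB hu hv m hc he
  have h2 := hF.tendsto_gaussLim hB √v m hc he
  refine le_of_tendsto (h1.sub h2).abs ?_
  filter_upwards [eventually_ge_atTop 1] with k hk
  have hk0 : (k : ℝ) ≠ 0 := by positivity
  have := hF.abs_add_points_sub_le hB (Multiset.replicate k (√u / √(k : ℝ)))
    (points (Multiset.replicate k (√v / √(k : ℝ))) + m) (by simp; omega) (by simp; omega)
  simp only [weight_add, weight_points, one_mul, Multiset.map_replicate, Multiset.sum_replicate,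
    nsmul_eq_mul, div_pow, Real.sq_sqrt hu, Real.sq_sqrt (Nat.cast_nonneg k),
    mul_div_cancel₀ _ hk0] at this
  exact this

lemma abs_gaussLim_sub_sub_le (hF : MarkedFamily s B F) (hB : 0 ≤ B) {u v : ℝ} (hu : 0 ≤ u)
    (hv : 0 ≤ v) (m : Multiset (ℕ × ℝ)) (hc : activeCard m + 3 ≤ s) (he : excess m + 1 ≤ s - 2) :
    |gaussLim F √(v + u) m - gaussLim F √v m - u / 2 * gaussLim F √v ((2, 0) ::ₘ m)|
      ≤ B * weight m * u ^ 2 := by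
  have h1 := hF.tendsto_split_variance hB hu hv m (by omega) he
  have h2 := hF.tendsto_gaussLim hB √v m (by omega) he
  have h3 := hF.tendsto_gaussLim hB √v ((2, 0) ::ₘ m) (by simp; omega) (by simpa using he)
  have h4 : Tendsto (fun k : ℕ => B * weight m * (√u ^ 3 / √(k : ℝ) + u ^ 2)) atTop
      (𝓝 (B * weight m * (0 + u ^ 2))) :=
    ((tendsto_const_div_sqrt _).add_const _).const_mul _
  rw [zero_add] at h4
  refine le_of_tendsto_of_tendsto ((h1.sub h2).sub (h3.const_mul (u / 2))).abs h4 ?_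
  filter_upwards [eventually_ge_atTop 1] with k hk
  have hk0 : (k : ℝ) ≠ 0 := by positivity
  have hk1 : √(k : ℝ) ≠ 0 := by positivity
  have := hF.abs_add_points_sub_sub_le hB (Multiset.replicate k (√u / √(k : ℝ)))
    (points (Multiset.replicate k (√v / √(k : ℝ))) + m) (by simp; omega) (by simp; omega)
  have e : (k : ℝ) * (√u / √(k : ℝ)) ^ 3 = √u ^ 3 / √(k : ℝ) := by
    have hk2 : (k : ℝ) = √(k : ℝ) ^ 2 := (Real.sq_sqrt (by positivity)).symm
    nth_rw 1 [hk2]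
    field_simp
  simp only [weight_add, weight_points, one_mul, Multiset.map_replicate, Multiset.sum_replicate,
    nsmul_eq_mul, abs_of_nonneg (show 0 ≤ √u / √(k : ℝ) by positivity), e] at this
  simp only [div_pow, Real.sq_sqrt hu, Real.sq_sqrt (Nat.cast_nonneg k),
    mul_div_cancel₀ _ hk0] at this
  rw [Multiset.add_cons]
  exact this

/-- The heat equation: the derivative in the variance `v = ρ²` is half of the second derivative in a
new argument at zero. -/
lemma hasDerivWithinAt_gaussLim_sqrt (hF : MarkedFamily s B F) (hB : 0 ≤ B) {v : ℝ}
    (hv : 0 ≤ v) (m : Multiset (ℕ × ℝ)) (hc : activeCard m + 3 ≤ s) (he : excess m + 1 ≤ s - 2) :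
    HasDerivWithinAt (fun v => gaussLim F √v m) (1 / 2 * gaussLim F √v ((2, 0) ::ₘ m))
      (Set.Ici 0) v := by
  have hw := mul_nonneg hB (weight_nonneg m)
  refine hasDerivWithinAt_of_abs_sub_le (C := 2 * (B * weight m)) fun x hx => ?_
  rcases le_total v x with h | h
  · have h1 := hF.abs_gaussLim_sub_sub_le hB (sub_nonneg.2 h) hv m hc he
    rw [add_sub_cancel] at h1
    have h2 : 0 ≤ B * weight m * (x - v) ^ 2 := by positivity
    rw [abs_le] at *
    constructor <;> linarith
  -- To the left of `v` the expansion is based at `x`; the coefficient is then moved to `v`.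
  · have h1 := hF.abs_gaussLim_sub_sub_le hB (sub_nonneg.2 h) hx m hc he
    have h2 := hF.abs_gaussLim_sub_le hB (sub_nonneg.2 h) hx ((2, 0) ::ₘ m)
      (by simp; omega) (by simpa using he)
    rw [add_sub_cancel] at h1 h2
    simp only [weight_cons, OfNat.ofNat_ne_one, if_false, one_mul] at h2
    have h3 : |(v - x) / 2 * (gaussLim F √v ((2, 0) ::ₘ m) - gaussLim F √x ((2, 0) ::ₘ m))|
        ≤ (v - x) / 2 * (B * weight m * (v - x)) := by
      rw [abs_mul, abs_of_nonneg (by linarith : 0 ≤ (v - x) / 2)]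
      have : 0 ≤ (v - x) / 2 := by linarith
      gcongr
    have h4 : 0 ≤ B * weight m * (x - v) ^ 2 := by positivity
    rw [abs_le] at *
    constructor <;> nlinarith

/-- Expansion of the limit in powers of a change of variance. -/
lemma abs_gaussLim_heat_le (hF : MarkedFamily s B F) (hB : 0 ≤ B) {u v : ℝ} (hu : 0 ≤ u)
    (hv : 0 ≤ v) (J : ℕ) (m : Multiset (ℕ × ℝ)) (hc : activeCard m + J + 2 ≤ s)
    (he : excess m + 1 ≤ s - 2) :
    |gaussLim F √v m - ∑ j ∈ Finset.range (J + 1), (-(u / 2)) ^ j / j.factorial *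
      gaussLim F √(v + u) (Multiset.replicate j (2, 0) + m)| ≤ B * weight m * u ^ (J + 1) := by
  have hw := mul_nonneg hB (weight_nonneg m)
  have hrep : ∀ j, activeCard (Multiset.replicate j (2, 0) + m) = activeCard m + j ∧
      excess (Multiset.replicate j (2, 0) + m) = excess m ∧
      weight (Multiset.replicate j (2, 0) + m) = weight m := by
    intro j
    induction j with
    | zero => simp
    | succ j ih =>
      rw [Multiset.replicate_succ, Multiset.cons_add]
      simp [ih, add_assoc]
  have := taylor_convex (convex_Ici (0 : ℝ)) (a := v + u) (C := B * weight m)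
    (Set.mem_Ici.2 (by linarith)) hw J
    (fun j x => (1 / 2) ^ j * gaussLim F √x (Multiset.replicate j (2, 0) + m)) ?_ ?_ v hv
  · simp only [pow_zero, one_mul, Multiset.replicate_zero, zero_add, sub_add_cancel_left,
      abs_neg, abs_of_nonneg hu] at this
    convert this using 4 with j
    rw [show -(u / 2) = -u * (1 / 2) by ring, mul_pow]
    ring
  · intro j hj x hx
    obtain ⟨h1, h2, -⟩ := hrep j
    have := (hF.hasDerivWithinAt_gaussLim_sqrt hB hx (Multiset.replicate j (2, 0) + m)
      (by omega) (by omega)).const_mul ((1 / 2 : ℝ) ^ j)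
    refine this.congr_deriv ?_
    rw [Multiset.replicate_succ, Multiset.cons_add]
    ring
  · intro x hx
    obtain ⟨h1, h2, h3⟩ := hrep J
    have key : ∀ y z : ℝ, 0 ≤ y → y ≤ z → |gaussLim F √z (Multiset.replicate J (2, 0) + m)
        - gaussLim F √y (Multiset.replicate J (2, 0) + m)| ≤ B * weight m * |z - y| := by
      intro y z hy hyz
      have := hF.abs_gaussLim_sub_le hB (sub_nonneg.2 hyz) hy (Multiset.replicate J (2, 0) + m)
        (by omega) (by omega)
      rwa [add_sub_cancel, h3, ← abs_of_nonneg (sub_nonneg.2 hyz)] at this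
    have key2 : |gaussLim F √x (Multiset.replicate J (2, 0) + m)
        - gaussLim F √(v + u) (Multiset.replicate J (2, 0) + m)| ≤ B * weight m * |x - (v + u)| := by
      rcases le_total (v + u) x with h | h
      · exact key _ _ (by positivity) h
      · rw [abs_sub_comm, abs_sub_comm x]
        exact key _ _ hx h
    rw [← mul_sub, abs_mul]
    refine (mul_le_of_le_one_left (abs_nonneg _) ?_).trans key2
    rw [abs_of_nonneg (by positivity)]
    exact pow_le_one₀ (by norm_num) (by norm_num)

end MarkedFamily

end SymmExpansion

namespace SymmExpansion

open PowerSeries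
open scoped Pointwise

/-! ### Exponentials of formal power series -/

/-- The exponential of a formal power series without constant term. -/
noncomputable def expSeries (A : PowerSeries DiffSymbols) : PowerSeries DiffSymbols :=
  (exp DiffSymbols).subst A

lemma derivative_expSeries {A : PowerSeries DiffSymbols} (hA : constantCoeff A = 0) :
    d⁄dX DiffSymbols (expSeries A) = expSeries A * d⁄dX DiffSymbols A := by
  rw [expSeries, derivative_subst (HasSubst.of_constantCoeff_zero' hA), derivative_exp]

lemma coeff_expSeries {A : PowerSeries DiffSymbols} (hA : constantCoeff A = 0) {r N : ℕ}
    (hN : r < N) : coeff r (expSeries A) =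
      ∑ m ∈ Finset.range N, MvPolynomial.C (1 / (m.factorial : ℝ)) * coeff r (A ^ m) := by
  rw [expSeries, coeff_subst' (HasSubst.of_constantCoeff_zero' hA), finsum_eq_sum_of_support_subset
    (s := Finset.range N)]
  · refine Finset.sum_congr rfl fun m _ => ?_
    rw [coeff_exp, smul_eq_mul]
    congr 1
    rw [IsScalarTower.algebraMap_apply ℚ ℝ DiffSymbols, MvPolynomial.algebraMap_eq]
    simp
  · intro m hm
    simp only [Finset.coe_range, Set.mem_Iio]
    by_contra hmN
    refine hm ?_
    have h0 : coeff r (A ^ m) = 0 := by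
      refine coeff_of_lt_order _ (lt_of_lt_of_le ?_ (le_order_pow_of_constantCoeff_eq_zero m hA))
      exact_mod_cast (by omega : r < m)
    simp only [h0, smul_zero]

lemma constantCoeff_expSeries {A : PowerSeries DiffSymbols} (hA : constantCoeff A = 0) :
    constantCoeff (expSeries A) = 1 := by
  rw [← coeff_zero_eq_constantCoeff_apply, coeff_expSeries hA (Nat.zero_lt_one)]
  simp

/-- A formal power series is determined by its logarithmic derivative and its constant term. -/
lemma eq_of_derivative_eq_mul {f g D : PowerSeries DiffSymbols}
    (hf : d⁄dX DiffSymbols f = f * D) (hg : d⁄dX DiffSymbols g = g * D)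
    (h0 : constantCoeff f = constantCoeff g) : f = g := by
  ext1 n
  induction n using Nat.strong_induction_on with
  | _ n ih =>
    cases n with
    | zero => simpa using h0
    | succ n =>
      have h1 := congrArg (coeff n) hf
      have h2 := congrArg (coeff n) hg
      rw [coeff_derivative, coeff_mul] at h1 h2
      have h3 : ∑ p ∈ Finset.HasAntidiagonal.antidiagonal n, coeff p.1 f * coeff p.2 D
          = ∑ p ∈ Finset.HasAntidiagonal.antidiagonal n, coeff p.1 g * coeff p.2 D :=
        Finset.sum_congr rfl fun p hp => by
          rw [ih p.1 (by have := Finset.HasAntidiagonal.mem_antidiagonal.1 hp; omega)]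
      rw [h3, ← h2] at h1
      exact mul_right_cancel₀ (by exact_mod_cast n.succ_ne_zero) h1

lemma expSeries_add {A A' : PowerSeries DiffSymbols} (hA : constantCoeff A = 0)
    (hA' : constantCoeff A' = 0) : expSeries (A + A') = expSeries A * expSeries A' := by
  refine eq_of_derivative_eq_mul (D := d⁄dX DiffSymbols (A + A'))
    (derivative_expSeries (by simp [hA, hA'])) ?_ ?_
  · rw [Derivation.leibniz, derivative_expSeries hA, derivative_expSeries hA', map_add]
    simp only [smul_eq_mul]
    ring
  · rw [map_mul, constantCoeff_expSeries hA, constantCoeff_expSeries hA',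
      constantCoeff_expSeries (by simp [hA, hA']), mul_one]

/-! ### The cumulant series -/

/-- The generating series `∑ κ_p(D) t^p / p!` of the cumulant operators. -/
noncomputable def cumulantSeries : PowerSeries DiffSymbols := logOf (1 + symbolSeries)

lemma coeff_symbolSeries (p : ℕ) : coeff p symbolSeries =
    if 2 ≤ p then MvPolynomial.C (1 / (p.factorial : ℝ)) * MvPolynomial.X p else 0 :=
  coeff_mk _ _

lemma constantCoeff_symbolSeries : constantCoeff symbolSeries = 0 := by
  rw [← coeff_zero_eq_constantCoeff_apply, coeff_symbolSeries]; simp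

lemma constantCoeff_cumulantSeries : constantCoeff cumulantSeries = 0 :=
  constantCoeff_logOf (by simp [constantCoeff_symbolSeries])

lemma derivative_cumulantSeries :
    (1 + symbolSeries) * d⁄dX DiffSymbols cumulantSeries = d⁄dX DiffSymbols symbolSeries := by
  have hs := HasSubst.of_constantCoeff_zero' constantCoeff_symbolSeries
  have h1 : (1 + X : PowerSeries DiffSymbols) * d⁄dX DiffSymbols (log DiffSymbols) = 1 := by
    rw [deriv_log]
    ext1 n
    rw [add_mul, one_mul, map_add]
    cases n with
    | zero => simp
    | succ n => simp [coeff_succ_X_mul, pow_succ]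
  have h2 := congrArg (fun f => f.subst symbolSeries) h1
  simp only [subst_mul hs, subst_add hs, subst_X hs] at h2
  have h3 : (1 : PowerSeries DiffSymbols).subst symbolSeries = (1 : PowerSeries DiffSymbols) := by
    rw [← coe_substAlgHom hs, map_one]
  rw [h3] at h2
  rw [cumulantSeries, logOf_eq, add_sub_cancel_left, derivative_subst hs, ← mul_assoc, h2, one_mul]

/-- The defining identity of the cumulants in exponential form. -/
lemma expSeries_cumulantSeries : expSeries cumulantSeries = 1 + symbolSeries := by
  refine eq_of_derivative_eq_mul (derivative_expSeries constantCoeff_cumulantSeries) ?_ ?_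
  · rw [derivative_cumulantSeries, map_add]
    simp
  · rw [constantCoeff_expSeries constantCoeff_cumulantSeries]
    simp [constantCoeff_symbolSeries]

/-- The formal polynomials in `D², D³, …` all of whose monomials have total order `p`. -/
noncomputable def homogeneousSymbols (p : ℕ) : Submodule ℝ DiffSymbols :=
  MvPolynomial.restrictSupport ℝ
    {μ | (∀ i ∈ Finsupp.toMultiset μ, 2 ≤ i) ∧ (Finsupp.toMultiset μ).sum = p}

/-- The exponents of the monomials `D^{p₁} ⋯ D^{p_m}` with all `p_j ≥ 2`, `m ≤ b`,
`∑ (p_j - 2) ≤ b` and `b ≤ ∑ p_j`. The last condition excludes the constant monomial, to which no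
bound applies, unless `b = 0`. -/
def gradedExponents (b : ℕ) : Set (ℕ →₀ ℕ) :=
  {μ | (∀ i ∈ Finsupp.toMultiset μ, 2 ≤ i) ∧ (Finsupp.toMultiset μ).card ≤ b ∧
    b ≤ (Finsupp.toMultiset μ).sum ∧
      (Finsupp.toMultiset μ).sum ≤ b + 2 * (Finsupp.toMultiset μ).card}

/-- The formal polynomials with exponents in `gradedExponents b`. -/
noncomputable def gradedSymbols (b : ℕ) : Submodule ℝ DiffSymbols :=
  MvPolynomial.restrictSupport ℝ (gradedExponents b)

lemma mul_mem_restrictSupport {S T U : Set (ℕ →₀ ℕ)} (h : S + T ⊆ U) {P Q : DiffSymbols}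
    (hP : P ∈ MvPolynomial.restrictSupport ℝ S) (hQ : Q ∈ MvPolynomial.restrictSupport ℝ T) :
    P * Q ∈ MvPolynomial.restrictSupport ℝ U := by
  refine MvPolynomial.restrictSupport_mono ℝ h ?_
  rw [MvPolynomial.restrictSupport_add]
  exact Submodule.mul_mem_mul hP hQ

lemma mul_mem_homogeneousSymbols {a b : ℕ} {P Q : DiffSymbols} (hP : P ∈ homogeneousSymbols a)
    (hQ : Q ∈ homogeneousSymbols b) : P * Q ∈ homogeneousSymbols (a + b) := by
  refine mul_mem_restrictSupport ?_ hP hQ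
  rintro _ ⟨μ, ⟨h1, h2⟩, ν, ⟨h3, h4⟩, rfl⟩
  refine ⟨fun i hi => ?_, ?_⟩
  · simp only [map_add, Multiset.mem_add] at hi
    exact hi.elim (h1 i) (h3 i)
  · simp only [map_add, Multiset.sum_add, h2, h4]

lemma add_mem_gradedExponents {a b : ℕ} {μ ν : ℕ →₀ ℕ} (hμ : μ ∈ gradedExponents a)
    (hν : ν ∈ gradedExponents b) : μ + ν ∈ gradedExponents (a + b) := by
  obtain ⟨h1, h2, h2', h2''⟩ := hμ
  obtain ⟨h3, h4, h4', h4''⟩ := hν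
  refine ⟨fun i hi => ?_, ?_, ?_, ?_⟩
  · simp only [map_add, Multiset.mem_add] at hi
    exact hi.elim (h1 i) (h3 i)
  · simp only [map_add, Multiset.card_add]; omega
  · simp only [map_add, Multiset.sum_add]; omega
  · simp only [map_add, Multiset.sum_add, Multiset.card_add]; omega

lemma zero_mem_gradedExponents : (0 : ℕ →₀ ℕ) ∈ gradedExponents 0 := by
  refine ⟨?_, ?_, ?_, ?_⟩ <;> simp

lemma mul_mem_gradedSymbols {a b : ℕ} {P Q : DiffSymbols} (hP : P ∈ gradedSymbols a)
    (hQ : Q ∈ gradedSymbols b) : P * Q ∈ gradedSymbols (a + b) := by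
  refine mul_mem_restrictSupport ?_ hP hQ
  rintro _ ⟨μ, hμ, ν, hν, rfl⟩
  exact add_mem_gradedExponents hμ hν

lemma one_mem_gradedSymbols : (1 : DiffSymbols) ∈ gradedSymbols 0 := by
  rw [gradedSymbols, show (1 : DiffSymbols) = MvPolynomial.monomial 0 1 from rfl,
    MvPolynomial.monomial_mem_restrictSupport]
  exact Or.inl zero_mem_gradedExponents

lemma C_mul_mem {M : Submodule ℝ DiffSymbols} {P : DiffSymbols} (hP : P ∈ M) (c : ℝ) :
    MvPolynomial.C c * P ∈ M := by
  rw [MvPolynomial.C_mul']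
  exact M.smul_mem c hP

lemma coeff_symbolSeries_mem (p : ℕ) : coeff p symbolSeries ∈ homogeneousSymbols p := by
  rw [coeff_symbolSeries]
  split_ifs with h
  · refine C_mul_mem ?_ _
    rw [homogeneousSymbols, MvPolynomial.X, MvPolynomial.monomial_mem_restrictSupport]
    left
    have e : Finsupp.toMultiset (fun₀ | p => 1) = {p} := by simp
    simp only [Set.mem_ofPred_eq, e, Multiset.mem_singleton, forall_eq, Multiset.sum_singleton]
    exact ⟨h, trivial⟩
  · exact zero_mem _

lemma coeff_cumulantSeries_succ (n : ℕ) :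
    coeff (n + 1) cumulantSeries * (n + 1 : DiffSymbols) +
      ∑ p ∈ Finset.HasAntidiagonal.antidiagonal n, coeff p.1 symbolSeries *
        (coeff (p.2 + 1) cumulantSeries * (p.2 + 1 : DiffSymbols))
      = coeff (n + 1) symbolSeries * (n + 1 : DiffSymbols) := by
  have h := congrArg (coeff n) derivative_cumulantSeries
  rw [add_mul, one_mul, map_add, coeff_mul] at h
  simpa only [coeff_derivative] using h

lemma natCast_add_one_eq_C (n : ℕ) : (n + 1 : DiffSymbols) = MvPolynomial.C ((n : ℝ) + 1) := by
  simp

lemma coeff_cumulantSeries_mem (p : ℕ) : coeff p cumulantSeries ∈ homogeneousSymbols p := by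
  induction p using Nat.strong_induction_on with
  | _ p ih =>
    cases p with
    | zero =>
      rw [coeff_zero_eq_constantCoeff_apply, constantCoeff_cumulantSeries]
      exact zero_mem _
    | succ n =>
      have h := eq_sub_of_add_eq (coeff_cumulantSeries_succ n)
      have hmem : coeff (n + 1) cumulantSeries * (n + 1 : DiffSymbols)
          ∈ homogeneousSymbols (n + 1) := by
        rw [h]
        refine sub_mem ?_ (sum_mem fun p hp => ?_)
        · rw [natCast_add_one_eq_C, mul_comm]
          exact C_mul_mem (coeff_symbolSeries_mem _) _
        · have hp' := Finset.HasAntidiagonal.mem_antidiagonal.1 hp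
          rcases Nat.eq_zero_or_pos p.1 with h0 | h0
          · rw [h0, coeff_zero_eq_constantCoeff_apply, constantCoeff_symbolSeries, zero_mul]
            exact zero_mem _
          · rw [show n + 1 = p.1 + (p.2 + 1) by omega, natCast_add_one_eq_C,
              mul_comm (coeff (p.2 + 1) _)]
            exact mul_mem_homogeneousSymbols (coeff_symbolSeries_mem _)
              (C_mul_mem (ih (p.2 + 1) (by omega)) _)
      have h2 := C_mul_mem hmem (1 / ((n : ℝ) + 1))
      rwa [natCast_add_one_eq_C, mul_left_comm, ← map_mul, one_div_mul_cancel (by positivity),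
        map_one, mul_one] at h2

lemma coeff_one_cumulantSeries : coeff 1 cumulantSeries = 0 := by
  have := coeff_cumulantSeries_succ 0
  simpa [constantCoeff_symbolSeries, coeff_symbolSeries] using this

lemma coeff_two_cumulantSeries :
    coeff 2 cumulantSeries = MvPolynomial.C (1 / 2 : ℝ) * MvPolynomial.X 2 := by
  have := coeff_cumulantSeries_succ 1
  rw [Finset.Nat.antidiagonal_succ] at this
  simp only [Finset.sum_cons, coeff_symbolSeries] at this
  have h2 : (1 + 1 : DiffSymbols) ≠ 0 := by
    rw [one_add_one_eq_two]; exact two_ne_zero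
  simpa [h2] using this

/-- For `j ≥ 1`, every monomial of `κ_{j+2}` has at most `j` factors. -/
lemma coeff_cumulantSeries_mem_graded {j : ℕ} (hj : 1 ≤ j) :
    coeff (j + 2) cumulantSeries ∈ gradedSymbols j := by
  refine MvPolynomial.restrictSupport_mono ℝ ?_ (coeff_cumulantSeries_mem (j + 2))
  rintro μ ⟨h1, h2⟩
  have h3 : (Finsupp.toMultiset μ).card * 2 ≤ (Finsupp.toMultiset μ).sum :=
    Multiset.card_nsmul_le_sum h1
  have h4 : (Finsupp.toMultiset μ).card ≠ 0 := by
    intro h0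
    rw [Multiset.card_eq_zero.1 h0] at h2
    simp at h2
  refine ⟨h1, ?_, ?_, ?_⟩ <;> omega

/-! ### The Edgeworth series -/

/-- The series `∑_{j ≥ 1} τ_{j+2} κ_{j+2} t^j / (j+2)!`, whose exponential generates the Edgeworth
polynomials. -/
noncomputable def edgeworthExponent (τ : ℕ → ℝ) : PowerSeries DiffSymbols :=
  PowerSeries.mk fun j =>
    if 1 ≤ j then MvPolynomial.C (τ (j + 2)) * coeff (j + 2) cumulantSeries else 0

/-- The generating series of the Edgeworth polynomials. -/
noncomputable def edgeworthSeries (τ : ℕ → ℝ) : PowerSeries DiffSymbols :=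
  expSeries (edgeworthExponent τ)

lemma coeff_edgeworthExponent (τ : ℕ → ℝ) (j : ℕ) : coeff j (edgeworthExponent τ) =
    if 1 ≤ j then MvPolynomial.C (τ (j + 2)) * coeff (j + 2) cumulantSeries else 0 :=
  coeff_mk _ _

lemma constantCoeff_edgeworthExponent (τ : ℕ → ℝ) :
    constantCoeff (edgeworthExponent τ) = 0 := by
  rw [← coeff_zero_eq_constantCoeff_apply, coeff_edgeworthExponent]; simp

lemma coeff_pow_eq_sum_antidiagonalTuple (A : PowerSeries DiffSymbols) (m r : ℕ) :
    coeff r (A ^ m) = ∑ j ∈ Finset.Nat.antidiagonalTuple m r, ∏ q : Fin m, coeff (j q) A := by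
  induction m generalizing r with
  | zero =>
    cases r <;> simp [coeff_one]
  | succ m ih =>
    rw [pow_succ', coeff_mul]
    simp_rw [ih, Finset.mul_sum]
    rw [Finset.sum_sigma']
    refine Finset.sum_bij' (fun p _ => Fin.cons p.1.1 p.2)
      (fun f _ => ⟨(f 0, ∑ i, Fin.tail f i), Fin.tail f⟩) ?_ ?_ ?_ ?_ ?_
    · rintro ⟨p, f⟩ h
      simp only [Finset.mem_sigma, Finset.HasAntidiagonal.mem_antidiagonal,
        Finset.Nat.mem_antidiagonalTuple] at h ⊢
      rw [Fin.sum_univ_succ]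
      simp [h.1, h.2]
    · intro f h
      simp only [Finset.mem_sigma, Finset.HasAntidiagonal.mem_antidiagonal,
        Finset.Nat.mem_antidiagonalTuple] at h ⊢
      rw [Fin.sum_univ_succ] at h
      exact ⟨h, trivial⟩
    · rintro ⟨⟨a, b⟩, f⟩ h
      simp only [Finset.mem_sigma, Finset.HasAntidiagonal.mem_antidiagonal,
        Finset.Nat.mem_antidiagonalTuple] at h
      simp [h.2]
    · intro f _
      simp
    · rintro ⟨p, f⟩ _
      rw [Fin.prod_univ_succ]
      simp

lemma coeff_edgeworthSeries (τ : ℕ → ℝ) {r : ℕ} (hr : 1 ≤ r) :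
    coeff r (edgeworthSeries τ) = edgeworth r τ := by
  rw [edgeworthSeries, coeff_expSeries (constantCoeff_edgeworthExponent τ) (Nat.lt_succ_self r),
    Finset.range_eq_Ico, Finset.sum_eq_sum_Ico_succ_bot (by omega), edgeworth]
  simp only [pow_zero, coeff_one, show r ≠ 0 by omega, if_false, mul_zero, zero_add]
  refine Finset.sum_congr rfl fun m _ => ?_
  rw [coeff_pow_eq_sum_antidiagonalTuple, Finset.sum_filter]
  congr 1
  refine Finset.sum_congr rfl fun j _ => ?_
  split_ifs with h
  · refine Finset.prod_congr rfl fun q _ => ?_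
    rw [coeff_edgeworthExponent, if_pos (h q), cumulant, ← mul_assoc, ← map_mul,
      div_mul_cancel₀ _ (by positivity)]
    rfl
  · push Not at h
    obtain ⟨q, hq⟩ := h
    exact Finset.prod_eq_zero (Finset.mem_univ q) (by rw [coeff_edgeworthExponent, if_neg (by omega)])

lemma coeff_zero_edgeworthSeries (τ : ℕ → ℝ) : coeff 0 (edgeworthSeries τ) = 1 := by
  rw [coeff_zero_eq_constantCoeff_apply, edgeworthSeries,
    constantCoeff_expSeries (constantCoeff_edgeworthExponent τ)]

lemma edgeworthSeries_add (τ τ' : ℕ → ℝ) :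
    edgeworthSeries (fun d => τ d + τ' d) = edgeworthSeries τ * edgeworthSeries τ' := by
  rw [edgeworthSeries, edgeworthSeries, edgeworthSeries, ← expSeries_add
    (constantCoeff_edgeworthExponent τ) (constantCoeff_edgeworthExponent τ')]
  congr 1
  ext1 j
  rw [map_add, coeff_edgeworthExponent, coeff_edgeworthExponent, coeff_edgeworthExponent]
  split_ifs <;> simp [add_mul]

lemma edgeworthSeries_zero : edgeworthSeries (fun _ => 0) = 1 := by
  have h : edgeworthExponent (fun _ => 0) = 0 := by
    ext1 j
    simp [coeff_edgeworthExponent]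
  ext1 r
  rw [edgeworthSeries, h, coeff_expSeries (map_zero _) (Nat.lt_succ_self r),
    Finset.sum_range_succ']
  simp

lemma coeff_edgeworthExponent_pow_mem (τ : ℕ → ℝ) (b m : ℕ) :
    coeff b (edgeworthExponent τ ^ m) ∈ gradedSymbols b := by
  induction m generalizing b with
  | zero =>
    rw [pow_zero, coeff_one]
    split_ifs with h
    · rw [h]; exact one_mem_gradedSymbols
    · exact zero_mem _
  | succ m ih =>
    rw [pow_succ, coeff_mul]
    refine sum_mem fun p hp => ?_
    rw [← Finset.HasAntidiagonal.mem_antidiagonal.1 hp]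
    refine mul_mem_gradedSymbols (ih p.1) ?_
    rw [coeff_edgeworthExponent]
    split_ifs with h
    · exact C_mul_mem (coeff_cumulantSeries_mem_graded h) _
    · exact zero_mem _

lemma edgeworth_mem (τ : ℕ → ℝ) {r : ℕ} (hr : 1 ≤ r) : edgeworth r τ ∈ gradedSymbols r := by
  rw [← coeff_edgeworthSeries τ hr, edgeworthSeries,
    coeff_expSeries (constantCoeff_edgeworthExponent τ) (Nat.lt_succ_self r)]
  exact sum_mem fun m _ => C_mul_mem (coeff_edgeworthExponent_pow_mem τ r m) _

/-- The contribution of the `m`-fold products of cumulants to the `b`-th Edgeworth polynomial of a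
single argument `x`; it comes with the factor `x ^ (b + 2 * m)`. -/
noncomputable def edgeworthPart (b m : ℕ) : DiffSymbols :=
  MvPolynomial.C (1 / (m.factorial : ℝ)) * coeff b (edgeworthExponent (fun _ => 1) ^ m)

lemma edgeworthPart_mem (b m : ℕ) : edgeworthPart b m ∈ gradedSymbols b :=
  C_mul_mem (coeff_edgeworthExponent_pow_mem _ b m) _

lemma edgeworthPart_zero_right {b : ℕ} (hb : 1 ≤ b) : edgeworthPart b 0 = 0 := by
  simp [edgeworthPart, coeff_one, show b ≠ 0 by omega]

lemma edgeworthPart_eq_zero {b m : ℕ} (h : b < m) : edgeworthPart b m = 0 := by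
  rw [edgeworthPart, coeff_of_lt_order, mul_zero]
  refine lt_of_lt_of_le ?_
    (le_order_pow_of_constantCoeff_eq_zero m (constantCoeff_edgeworthExponent _))
  exact_mod_cast h

lemma coeff_edgeworthSeries_pow (x : ℝ) {b N : ℕ} (hN : b < N) :
    coeff b (edgeworthSeries fun d => x ^ d) =
      ∑ m ∈ Finset.range N, MvPolynomial.C (x ^ (b + 2 * m)) * edgeworthPart b m := by
  have h : edgeworthExponent (fun d => x ^ d) =
      C (MvPolynomial.C (x ^ 2)) * rescale (MvPolynomial.C x) (edgeworthExponent fun _ => 1) := by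
    ext1 j
    rw [coeff_C_mul, coeff_rescale, coeff_edgeworthExponent, coeff_edgeworthExponent]
    split_ifs
    · rw [pow_add, map_mul, map_one, one_mul, map_pow _ x j]; ring
    · simp
  rw [edgeworthSeries, coeff_expSeries (constantCoeff_edgeworthExponent _) hN]
  refine Finset.sum_congr rfl fun m _ => ?_
  rw [h, mul_pow, ← map_pow, ← map_pow (rescale (MvPolynomial.C x : DiffSymbols)), ← map_pow,
    coeff_C_mul, coeff_rescale, edgeworthPart, ← map_pow, pow_add, map_mul, ← pow_mul]
  ring

lemma cumulantSeries_eq_add : cumulantSeries =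
    X ^ 2 * edgeworthExponent (fun _ => 1) + C (coeff 2 cumulantSeries) * X ^ 2 := by
  ext1 j
  rw [map_add, coeff_X_pow_mul', coeff_C_mul, coeff_X_pow]
  rcases j with _ | _ | _ | j
  · simp [constantCoeff_cumulantSeries]
  · simp [coeff_one_cumulantSeries]
  · simp [constantCoeff_edgeworthExponent]
  · simp [coeff_edgeworthExponent]

lemma coeff_expSeries_mul_X_sq (c : DiffSymbols) {i N : ℕ} (hN : i < N) :
    coeff i (expSeries (C c * X ^ 2)) =
      ∑ m ∈ Finset.range N, if i = 2 * m then MvPolynomial.C (1 / (m.factorial : ℝ)) * c ^ m else 0 := by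
  rw [coeff_expSeries (by simp) hN]
  refine Finset.sum_congr rfl fun m _ => ?_
  rw [mul_pow, ← map_pow, ← pow_mul, coeff_C_mul, coeff_X_pow]
  split_ifs <;> simp

/-- The formal operator `(1 + ∑ D^p t^p / p!) exp(-t² D² / 2)` of replacing a variance by an
argument. -/
noncomputable def swapSeries : PowerSeries DiffSymbols :=
  expSeries (X ^ 2 * edgeworthExponent (fun _ => 1))

lemma swapSeries_eq : swapSeries =
    (1 + symbolSeries) * expSeries (C (-coeff 2 cumulantSeries) * X ^ 2) := by
  rw [← expSeries_cumulantSeries, ← expSeries_add constantCoeff_cumulantSeries (by simp)]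
  nth_rw 1 [cumulantSeries_eq_add]
  rw [map_neg, neg_mul, add_neg_cancel_right, swapSeries]

lemma coeff_swapSeries {w N : ℕ} (hN : w < N) : coeff w swapSeries =
    ∑ b ∈ Finset.range N, ∑ m ∈ Finset.range N, if b + 2 * m = w then edgeworthPart b m else 0 := by
  rw [swapSeries, coeff_expSeries (by simp) hN, Finset.sum_comm]
  refine Finset.sum_congr rfl fun m _ => ?_
  rw [mul_pow, ← pow_mul, coeff_X_pow_mul']
  split_ifs with h
  · rw [Finset.sum_eq_single (w - 2 * m), if_pos (by omega), edgeworthPart]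
    · intro b _ hb
      rw [if_neg (by omega)]
    · intro hb
      exact absurd (Finset.mem_range.2 (by omega)) hb
  · rw [mul_zero, Finset.sum_eq_zero]
    intro b _
    rw [if_neg (by omega)]

/-- For a single argument `x`, truncating the Edgeworth series at the order `K` and truncating the swap
series at the power `x ^ (K + 2)` differ only by terms of the Edgeworth series that contain higher
powers of `x`. -/
lemma sum_coeff_edgeworthSeries_pow (x : ℝ) {K : ℕ} (hK : 1 ≤ K) :
    ∑ b ∈ Finset.range K, coeff b (edgeworthSeries fun d => x ^ d) =
      ∑ w ∈ Finset.range (K + 2), MvPolynomial.C (x ^ w) * coeff w swapSeries +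
      ∑ b ∈ Finset.range K, ∑ m ∈ Finset.range (K + 2),
        if K + 2 ≤ b + 2 * m then MvPolynomial.C (x ^ (b + 2 * m)) * edgeworthPart b m else 0 := by
  have h1 : ∑ w ∈ Finset.range (K + 2), MvPolynomial.C (x ^ w) * coeff w swapSeries =
      ∑ b ∈ Finset.range (K + 2), ∑ m ∈ Finset.range (K + 2), if b + 2 * m < K + 2 then
        MvPolynomial.C (x ^ (b + 2 * m)) * edgeworthPart b m else 0 := by
    have : ∀ w ∈ Finset.range (K + 2), MvPolynomial.C (x ^ w) * coeff w swapSeries =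
        ∑ b ∈ Finset.range (K + 2), ∑ m ∈ Finset.range (K + 2), if b + 2 * m = w then
          MvPolynomial.C (x ^ (b + 2 * m)) * edgeworthPart b m else 0 := by
      intro w hw
      rw [coeff_swapSeries (Finset.mem_range.1 hw), Finset.mul_sum]
      refine Finset.sum_congr rfl fun b _ => ?_
      rw [Finset.mul_sum]
      refine Finset.sum_congr rfl fun m _ => ?_
      split_ifs with h
      · rw [h]
      · rw [mul_zero]
    rw [Finset.sum_congr rfl this, Finset.sum_comm]
    refine Finset.sum_congr rfl fun b _ => ?_
    rw [Finset.sum_comm]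
    refine Finset.sum_congr rfl fun m _ => ?_
    rw [Finset.sum_ite_eq]
    simp only [Finset.mem_range]
  have h2 : ∀ b, K ≤ b → ∑ m ∈ Finset.range (K + 2), (if b + 2 * m < K + 2 then
        MvPolynomial.C (x ^ (b + 2 * m)) * edgeworthPart b m else 0) = 0 := by
    intro b hb
    refine Finset.sum_eq_zero fun m _ => ?_
    split_ifs with h
    · obtain rfl : m = 0 := by omega
      rw [edgeworthPart_zero_right (by omega), mul_zero]
    · rfl
  rw [h1, Finset.sum_range_succ, Finset.sum_range_succ, h2 K le_rfl, h2 (K + 1) (by omega),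
    add_zero, add_zero, ← Finset.sum_add_distrib]
  refine Finset.sum_congr rfl fun b hb => ?_
  rw [coeff_edgeworthSeries_pow x (show b < K + 2 by have := Finset.mem_range.1 hb; omega),
    ← Finset.sum_add_distrib]
  refine Finset.sum_congr rfl fun m _ => ?_
  split_ifs <;> first | omega | simp

lemma sum_range_even {M : Type*} [AddCommMonoid M] (g : ℕ → M) (N : ℕ) :
    ∑ i ∈ Finset.range N, ∑ m ∈ Finset.range N, (if i = 2 * m then g m else 0)
      = ∑ j ∈ Finset.range ((N + 1) / 2), g j := by
  rw [Finset.sum_comm, ← Finset.sum_subset (Finset.range_mono (show (N + 1) / 2 ≤ N by omega))]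
  · refine Finset.sum_congr rfl fun m hm => ?_
    rw [Finset.sum_ite_eq', if_pos]
    rw [Finset.mem_range] at *
    omega
  · intro m _ hm
    rw [Finset.sum_ite_eq', if_neg]
    rw [Finset.mem_range] at *
    omega

lemma sum_coeff_swapSeries (x : ℝ) (N : ℕ) :
    ∑ w ∈ Finset.range N, MvPolynomial.C (x ^ w) * coeff w swapSeries =
      ∑ p ∈ Finset.range N, ∑ j ∈ Finset.range ((N - p + 1) / 2),
        MvPolynomial.C (x ^ p * ((-(x ^ 2 / 2)) ^ j / j.factorial)) *
          (coeff p (1 + symbolSeries) * MvPolynomial.X 2 ^ j) := by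
  set ψ := expSeries (C (-coeff 2 cumulantSeries) * X ^ 2) with hψ
  have h1 : ∀ w, MvPolynomial.C (x ^ w) * coeff w swapSeries = ∑ p ∈ Finset.range (w + 1),
      MvPolynomial.C (x ^ p) * coeff p (1 + symbolSeries) *
        (MvPolynomial.C (x ^ (w - p)) * coeff (w - p) ψ) := by
    intro w
    rw [swapSeries_eq, coeff_mul, Finset.Nat.sum_antidiagonal_eq_sum_range_succ_mk, Finset.mul_sum]
    refine Finset.sum_congr rfl fun p hp => ?_
    have : w = p + (w - p) := by have := Finset.mem_range.1 hp; omega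
    nth_rw 1 [this]
    rw [pow_add, map_mul]
    ring
  rw [Finset.sum_congr rfl fun w _ => h1 w, Finset.sum_range_diag_flip N fun p i =>
    MvPolynomial.C (x ^ p) * coeff p (1 + symbolSeries) * (MvPolynomial.C (x ^ i) * coeff i ψ)]
  refine Finset.sum_congr rfl fun p _ => ?_
  rw [← Finset.mul_sum]
  have h2 : ∑ i ∈ Finset.range (N - p), MvPolynomial.C (x ^ i) * coeff i ψ =
      ∑ j ∈ Finset.range ((N - p + 1) / 2),
        MvPolynomial.C ((-(x ^ 2 / 2)) ^ j / j.factorial) * MvPolynomial.X 2 ^ j := by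
    rw [← sum_range_even]
    refine Finset.sum_congr rfl fun i hi => ?_
    rw [hψ, coeff_expSeries_mul_X_sq _ (Finset.mem_range.1 hi), Finset.mul_sum]
    refine Finset.sum_congr rfl fun m _ => ?_
    split_ifs with h
    · rw [coeff_two_cumulantSeries, ← neg_mul, ← map_neg, mul_pow, ← map_pow, ← mul_assoc,
        ← mul_assoc, ← map_mul, ← map_mul, h, pow_mul]
      congr 2
      rw [show -(x ^ 2 / 2) = x ^ 2 * (-(1 / 2)) by ring, mul_pow]
      ring
    · rw [mul_zero]
  rw [h2, Finset.mul_sum]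
  refine Finset.sum_congr rfl fun j _ => ?_
  rw [map_mul]
  ring

end SymmExpansion

namespace SymmExpansion

open PowerSeries

/-! ### Evaluating differential symbols in the Gaussian limit -/

/-- The marks at zero prescribed by a monomial `D^{p₁} ⋯ D^{p_m}`. -/
noncomputable def symbolMarks (μ : ℕ →₀ ℕ) : Multiset (ℕ × ℝ) := (Finsupp.toMultiset μ).map fun p => (p, 0)

@[simp] lemma symbolMarks_zero : symbolMarks 0 = 0 := by simp [symbolMarks]

lemma symbolMarks_add (μ ν : ℕ →₀ ℕ) : symbolMarks (μ + ν) = symbolMarks μ + symbolMarks ν := by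
  simp [symbolMarks]

lemma symbolMarks_single (p j : ℕ) :
    symbolMarks (Finsupp.single p j) = Multiset.replicate j (p, 0) := by
  simp [symbolMarks, Multiset.nsmul_singleton]

lemma map_marks_bounds (t : Multiset ℕ) (h : ∀ i ∈ t, 2 ≤ i) :
    activeCard (t.map fun p => (p, (0 : ℝ))) = t.card ∧
      excess (t.map fun p => (p, (0 : ℝ))) + 2 * t.card = t.sum ∧
      weight (t.map fun p => (p, (0 : ℝ))) = 1 := by
  induction t using Multiset.induction with
  | empty => simp
  | cons p t ih =>
    obtain ⟨h1, h2, h3⟩ := ih fun i hi => h i (Multiset.mem_cons_of_mem hi)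
    have hp := h p (Multiset.mem_cons_self p t)
    simp only [Multiset.map_cons, activeCard_cons, excess_cons, weight_cons, Multiset.card_cons,
      Multiset.sum_cons, h1, h3, show p ≠ 0 by omega, show p ≠ 1 by omega, if_false, mul_one,
      and_true, true_and]
    omega

lemma symbolMarks_bounds {b : ℕ} {μ : ℕ →₀ ℕ} (hμ : μ ∈ gradedExponents b) :
    activeCard (symbolMarks μ) ≤ b ∧ excess (symbolMarks μ) ≤ b ∧ weight (symbolMarks μ) = 1 ∧
      (1 ≤ b → ∃ q ∈ symbolMarks μ, q.1 ≠ 0) := by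
  obtain ⟨h1, h2, h3, h4⟩ := hμ
  obtain ⟨h5, h6, h7⟩ := map_marks_bounds _ h1
  refine ⟨?_, ?_, h7, fun hb => ?_⟩
  · rw [symbolMarks, h5]; exact h2
  · rw [symbolMarks]; omega
  · obtain ⟨p, hp⟩ := Multiset.exists_mem_of_ne_zero (s := Finsupp.toMultiset μ) (by
      intro h0; rw [h0] at h3; simp at h3; omega)
    exact ⟨(p, 0), Multiset.mem_map_of_mem _ hp, by have := h1 p hp; simp; omega⟩

/-- The action of a polynomial in the symbols `D^p` on the limit function with variance `v` and
further arguments `X`: each symbol differentiates at zero in an argument of its own. -/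
noncomputable def gaussEval (F : Multiset (ℕ × ℝ) → ℝ) (v : ℝ) (X : Multiset ℝ) :
    DiffSymbols →ₗ[ℝ] ℝ :=
  (MvPolynomial.basisMonomials ℕ ℝ).constr ℝ fun μ => gaussLim F √v (symbolMarks μ + points X)

lemma gaussEval_monomial (F : Multiset (ℕ × ℝ) → ℝ) (v : ℝ) (X : Multiset ℝ) (μ : ℕ →₀ ℕ) :
    gaussEval F v X (MvPolynomial.monomial μ 1) = gaussLim F √v (symbolMarks μ + points X) := by
  have := (MvPolynomial.basisMonomials ℕ ℝ).constr_basis ℝ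
    (fun μ => gaussLim F √v (symbolMarks μ + points X)) μ
  rwa [MvPolynomial.coe_basisMonomials] at this

lemma linearMap_eq_sum (Λ : DiffSymbols →ₗ[ℝ] ℝ) (Q : DiffSymbols) :
    Λ Q = ∑ μ ∈ Q.support, Q.coeff μ * Λ (MvPolynomial.monomial μ 1) := by
  conv_lhs => rw [← MvPolynomial.support_sum_monomial_coeff Q]
  rw [map_sum]
  refine Finset.sum_congr rfl fun μ _ => ?_
  rw [← smul_eq_mul, ← map_smul, MvPolynomial.smul_monomial, smul_eq_mul, mul_one]

/-- The sum of the absolute values of the coefficients. -/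
noncomputable def coeffNorm (Q : DiffSymbols) : ℝ := ∑ μ ∈ Q.support, |Q.coeff μ|

lemma coeffNorm_nonneg (Q : DiffSymbols) : 0 ≤ coeffNorm Q :=
  Finset.sum_nonneg fun _ _ => abs_nonneg _

lemma abs_linearMap_le (Λ : DiffSymbols →ₗ[ℝ] ℝ) {b : ℕ} {Q : DiffSymbols}
    (hQ : Q ∈ gradedSymbols b) {C : ℝ}
    (h : ∀ μ ∈ gradedExponents b, |Λ (MvPolynomial.monomial μ 1)| ≤ C) :
    |Λ Q| ≤ coeffNorm Q * C := by
  rw [linearMap_eq_sum Λ Q, coeffNorm, Finset.sum_mul]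
  refine (Finset.abs_sum_le_sum_abs _ _).trans (Finset.sum_le_sum fun μ hμ => ?_)
  rw [abs_mul]
  have := h μ ((MvPolynomial.mem_restrictSupport_iff ℝ).1 hQ hμ)
  gcongr

lemma linearMap_C_mul (Λ : DiffSymbols →ₗ[ℝ] ℝ) (c : ℝ) (Q : DiffSymbols) :
    Λ (MvPolynomial.C c * Q) = c * Λ Q := by
  rw [MvPolynomial.C_mul', map_smul, smul_eq_mul]

/-! ### Replacing one argument -/

/-- The constant in the replacement of one argument by a variance. -/
noncomputable def swapConst (K : ℕ) : ℝ :=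
  1 + (K + 2) + ∑ b ∈ Finset.range K, ∑ m ∈ Finset.range (K + 2), coeffNorm (edgeworthPart b m)

lemma swapConst_nonneg (K : ℕ) : 0 ≤ swapConst K := by
  have := Finset.sum_nonneg fun b (_ : b ∈ Finset.range K) =>
    Finset.sum_nonneg fun m (_ : m ∈ Finset.range (K + 2)) => coeffNorm_nonneg (edgeworthPart b m)
  unfold swapConst
  positivity

namespace MarkedFamily

variable {s : ℕ} {B : ℝ} {F : Multiset (ℕ × ℝ) → ℝ}

lemma gaussEval_symbol (hF : MarkedFamily s B F) (v : ℝ) (X : Multiset ℝ) (μ : ℕ →₀ ℕ) (p j : ℕ)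
    (hc : activeCard (Multiset.replicate j (2, 0) + (symbolMarks μ + points X)) + 1 ≤ s)
    (he : excess (Multiset.replicate j (2, 0) + (symbolMarks μ + points X)) ≤ s - 2) :
    gaussEval F v X (MvPolynomial.monomial μ 1 *
      (coeff p (1 + symbolSeries) * MvPolynomial.X 2 ^ j)) =
    1 / p.factorial *
      gaussLim F √v (Multiset.replicate j (2, 0) + (p, 0) ::ₘ (symbolMarks μ + points X)) := by
  have hX2 : (MvPolynomial.X 2 : DiffSymbols) ^ j = MvPolynomial.monomial (Finsupp.single 2 j) 1 :=
    MvPolynomial.X_pow_eq_monomial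
  rw [map_add, coeff_symbolSeries, coeff_one, Multiset.add_cons]
  rcases p with _ | _ | p
  · rw [hF.gaussLim_zero_mark _ _ (by omega) he]
    simp only [if_true, show ¬ (2 ≤ 0) by omega, if_false, add_zero, one_mul, hX2, Nat.factorial_zero,
      MvPolynomial.monomial_mul, gaussEval_monomial]
    rw [symbolMarks_add, symbolMarks_single]
    simp only [Nat.cast_one, div_one, one_mul]
    congr 1
    abel
  · rw [hF.gaussLim_one_mark _ _ (by omega) he]
    simp
  · rw [if_neg (by omega), if_pos (by omega), zero_add, mul_assoc, mul_left_comm, linearMap_C_mul,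
      hX2, MvPolynomial.X, MvPolynomial.monomial_mul, MvPolynomial.monomial_mul, one_mul, one_mul,
      gaussEval_monomial]
    rw [symbolMarks_add, symbolMarks_add, symbolMarks_single, symbolMarks_single]
    congr 2
    rw [← Multiset.singleton_add, Multiset.replicate_one]
    abel

/-- Replacing an argument `x` by the additional variance `x²`. -/
lemma abs_gaussEval_swap_le (hF : MarkedFamily s B F) (hB : 0 ≤ B) {a K : ℕ} (hK : 1 ≤ K)
    (hs : a + K + 2 = s) {μ : ℕ →₀ ℕ} (hμ : μ ∈ gradedExponents a) (X : Multiset ℝ) {x v : ℝ}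
    (hx : |x| ≤ 1) (hv : 0 ≤ v) :
    |gaussEval F v (x ::ₘ X) (MvPolynomial.monomial μ 1) -
      gaussEval F (v + x ^ 2) X (MvPolynomial.monomial μ 1 *
        ∑ b ∈ Finset.range K, coeff b (edgeworthSeries fun d => x ^ d))|
      ≤ swapConst K * B * |x| ^ (K + 2) := by
  obtain ⟨h1, h2, h3, h4⟩ := symbolMarks_bounds hμ
  set m := symbolMarks μ + points X with hm
  have hmc : activeCard m ≤ a := by simpa [hm] using h1
  have hme : excess m ≤ a := by simpa [hm] using h2
  have hmw : weight m = 1 := by simpa [hm] using h3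
  have hrep : ∀ j, activeCard (Multiset.replicate j (2, 0) + m) = activeCard m + j ∧
      excess (Multiset.replicate j (2, 0) + m) = excess m := by
    intro j
    induction j with
    | zero => simp
    | succ j ih =>
      rw [Multiset.replicate_succ, Multiset.cons_add]
      simp [ih, add_assoc]
  have hpow : ∀ n, K + 2 ≤ n → |x| ^ n ≤ |x| ^ (K + 2) := fun n hn =>
    pow_le_pow_of_le_one (abs_nonneg x) hx hn
  -- Taylor expansion in `x`.
  have e1 : |gaussEval F v (x ::ₘ X) (MvPolynomial.monomial μ 1) - ∑ p ∈ Finset.range (K + 2),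
      x ^ p / p.factorial * gaussLim F √v ((p, 0) ::ₘ m)| ≤ B * |x| ^ (K + 2) := by
    have := hF.abs_gaussLim_taylor_le hB √v 0 K 0 x m (by omega) (by omega) (by omega)
    rw [gaussEval_monomial, points_cons, Multiset.add_cons, ← hm]
    simpa [hmw] using this
  -- The heat equation replaces the variance `v` by `v + x ^ 2`.
  have e2 : ∀ p ∈ Finset.range (K + 2), |x ^ p / p.factorial * gaussLim F √v ((p, 0) ::ₘ m) -
      gaussEval F (v + x ^ 2) X (MvPolynomial.monomial μ 1 *
        ∑ j ∈ Finset.range ((K + 2 - p + 1) / 2),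
          MvPolynomial.C (x ^ p * ((-(x ^ 2 / 2)) ^ j / j.factorial)) *
            (coeff p (1 + symbolSeries) * MvPolynomial.X 2 ^ j))| ≤ B * |x| ^ (K + 2) := by
    intro p hp
    rw [Finset.mem_range] at hp
    have hpc : activeCard ((p, 0) ::ₘ m) ≤ a + min p 1 := by
      simp only [activeCard_cons]; split_ifs <;> omega
    have hpe : excess ((p, 0) ::ₘ m) ≤ a + (p - 2) := by
      simp only [excess_cons]; omega
    have hpw : weight ((p, 0) ::ₘ m) ≤ 1 := by
      simp only [weight_cons, hmw]; split_ifs <;> simp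
    have hh := hF.abs_gaussLim_heat_le hB (sq_nonneg x) hv ((K + 1 - p) / 2) ((p, 0) ::ₘ m)
      (by omega) (by omega)
    have hJ : (K + 2 - p + 1) / 2 = (K + 1 - p) / 2 + 1 := by omega
    have hsum : gaussEval F (v + x ^ 2) X (MvPolynomial.monomial μ 1 *
        ∑ j ∈ Finset.range ((K + 2 - p + 1) / 2),
          MvPolynomial.C (x ^ p * ((-(x ^ 2 / 2)) ^ j / j.factorial)) *
            (coeff p (1 + symbolSeries) * MvPolynomial.X 2 ^ j)) =
        x ^ p / p.factorial * ∑ j ∈ Finset.range ((K + 1 - p) / 2 + 1),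
          (-(x ^ 2 / 2)) ^ j / j.factorial *
            gaussLim F √(v + x ^ 2) (Multiset.replicate j (2, 0) + (p, 0) ::ₘ m) := by
      rw [Finset.mul_sum, Finset.mul_sum, map_sum, hJ]
      refine Finset.sum_congr rfl fun j hj => ?_
      rw [Finset.mem_range] at hj
      rw [mul_left_comm, linearMap_C_mul, hF.gaussEval_symbol _ _ _ _ _
        (by rw [← hm, (hrep j).1]; omega) (by rw [← hm, (hrep j).2]; omega)]
      ring
    rw [hsum, ← mul_sub, abs_mul, abs_div, abs_pow, Nat.abs_cast]
    have hf : (1 : ℝ) ≤ p.factorial := by exact_mod_cast p.factorial_pos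
    calc |x| ^ p / p.factorial * _
        ≤ |x| ^ p * (B * 1 * (x ^ 2) ^ ((K + 1 - p) / 2 + 1)) := by
          refine mul_le_mul (div_le_self (by positivity) hf) (hh.trans ?_) (abs_nonneg _)
            (by positivity)
          gcongr
      _ = B * |x| ^ (p + 2 * ((K + 1 - p) / 2 + 1)) := by
          rw [← sq_abs x, ← pow_mul, mul_one, pow_add |x| p]; ring
      _ ≤ B * |x| ^ (K + 2) := mul_le_mul_of_nonneg_left (hpow _ (by omega)) hB
  -- Terms of the Edgeworth polynomials that are of higher order in `x`.
  have e3 : ∀ b ∈ Finset.range K, ∀ n ∈ Finset.range (K + 2),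
      |gaussEval F (v + x ^ 2) X (MvPolynomial.monomial μ 1 * (if K + 2 ≤ b + 2 * n then
        MvPolynomial.C (x ^ (b + 2 * n)) * edgeworthPart b n else 0))|
        ≤ coeffNorm (edgeworthPart b n) * (B * |x| ^ (K + 2)) := by
    intro b hb n _
    rw [Finset.mem_range] at hb
    have hN := coeffNorm_nonneg (edgeworthPart b n)
    split_ifs with hbn
    · rcases Nat.eq_zero_or_pos b with rfl | hb0
      · rw [edgeworthPart_eq_zero (show 0 < n by omega)]
        simp [coeffNorm]
      · rw [mul_left_comm, linearMap_C_mul, abs_mul, abs_pow]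
        have := abs_linearMap_le ((gaussEval F (v + x ^ 2) X) ∘ₗ
          LinearMap.mulLeft ℝ (MvPolynomial.monomial μ 1)) (edgeworthPart_mem b n) (C := B) ?_
        · simp only [LinearMap.coe_comp, Function.comp_apply, LinearMap.mulLeft_apply] at this
          calc _ ≤ |x| ^ (K + 2) * (coeffNorm (edgeworthPart b n) * B) :=
                mul_le_mul (hpow _ hbn) this (abs_nonneg _) (by positivity)
            _ = _ := by ring
        · intro ν hν
          obtain ⟨k1, k2, k3, k4⟩ := symbolMarks_bounds (add_mem_gradedExponents hμ hν)
          obtain ⟨q, hq, hq0⟩ := k4 (by omega)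
          simp only [LinearMap.coe_comp, Function.comp_apply, LinearMap.mulLeft_apply,
            MvPolynomial.monomial_mul, one_mul, gaussEval_monomial]
          have := hF.abs_gaussLim_le hB √(v + x ^ 2) (symbolMarks (μ + ν) + points X)
            (by simp; omega) (by simp; omega) ⟨q, by simp [hq], hq0⟩
          simpa [k3] using this
    · simp only [mul_zero, map_zero, abs_zero]
      positivity
  rw [sum_coeff_edgeworthSeries_pow x hK, sum_coeff_swapSeries, mul_add, map_add]
  simp only [Finset.mul_sum (Finset.range K), Finset.mul_sum (Finset.range (K + 2)), map_sum]
  have a2 := Finset.abs_sum_le_sum_abs (fun p => x ^ p / p.factorial * gaussLim F √v ((p, 0) ::ₘ m) -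
      gaussEval F (v + x ^ 2) X (MvPolynomial.monomial μ 1 *
        ∑ j ∈ Finset.range ((K + 2 - p + 1) / 2),
          MvPolynomial.C (x ^ p * ((-(x ^ 2 / 2)) ^ j / j.factorial)) *
            (coeff p (1 + symbolSeries) * MvPolynomial.X 2 ^ j))) (Finset.range (K + 2))
  have a2' := a2.trans (Finset.sum_le_sum e2)
  rw [Finset.sum_sub_distrib, Finset.sum_const, Finset.card_range, nsmul_eq_mul] at a2'
  have a3 := (Finset.abs_sum_le_sum_abs _ _).trans (Finset.sum_le_sum fun b hb =>
    (Finset.abs_sum_le_sum_abs _ _).trans (Finset.sum_le_sum (e3 b hb)))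
  simp only [← Finset.sum_mul] at a3
  push_cast at a2'
  rw [swapConst]
  rw [abs_le] at *
  constructor <;> nlinarith

end MarkedFamily

end SymmExpansion

namespace SymmExpansion

open PowerSeries

/-! ### The expansion for all arguments -/

lemma sum_abs_pow_nonneg (U : Multiset ℝ) (k : ℕ) : 0 ≤ (U.map (|·| ^ k)).sum :=
  Multiset.sum_nonneg fun x hx => by
    obtain ⟨y, -, rfl⟩ := Multiset.mem_map.1 hx
    positivity

lemma sum_abs_pow_mono {T U : Multiset ℝ} (h : T ≤ U) (k : ℕ) :
    (T.map (|·| ^ k)).sum ≤ (U.map (|·| ^ k)).sum := by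
  obtain ⟨R, rfl⟩ := Multiset.le_iff_exists_add.1 h
  rw [Multiset.map_add, Multiset.sum_add]
  exact le_add_of_nonneg_right (sum_abs_pow_nonneg R k)

lemma pow_mul_sum_add_le (x : ℝ) (U : Multiset ℝ) (a b : ℕ) :
    |x| ^ a * (U.map (|·| ^ (b + 2))).sum + |x| ^ b * (U.map (|·| ^ (a + 2))).sum ≤
      |x| ^ (a + b) * (U.map (|·| ^ 2)).sum + (U.map (|·| ^ (a + b + 2))).sum := by
  induction U using Multiset.induction with
  | empty => simp
  | cons y U ih =>
    simp only [Multiset.map_cons, Multiset.sum_cons]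
    have h1 : 0 ≤ (|x| ^ a - |y| ^ a) * (|x| ^ b - |y| ^ b) := by
      rcases le_total |x| |y| with h | h
      · exact mul_nonneg_of_nonpos_of_nonpos
          (sub_nonpos.2 (pow_le_pow_left₀ (abs_nonneg _) h _))
          (sub_nonpos.2 (pow_le_pow_left₀ (abs_nonneg _) h _))
      · exact mul_nonneg
          (sub_nonneg.2 (pow_le_pow_left₀ (abs_nonneg _) h _))
          (sub_nonneg.2 (pow_le_pow_left₀ (abs_nonneg _) h _))
    have h2 : 0 ≤ |y| ^ 2 * ((|x| ^ a - |y| ^ a) * (|x| ^ b - |y| ^ b)) := by positivity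
    have e : |y| ^ 2 * ((|x| ^ a - |y| ^ a) * (|x| ^ b - |y| ^ b)) =
        |x| ^ (a + b) * |y| ^ 2 + |y| ^ (a + b + 2) - |x| ^ a * |y| ^ (b + 2)
          - |x| ^ b * |y| ^ (a + 2) := by ring
    rw [e] at h2
    linarith

/-- Chebyshev's inequality for power sums: with respect to the weights `x²`, powers of `|x|` are
positively correlated. -/
lemma sum_abs_pow_mul_le (U : Multiset ℝ) (a b : ℕ) :
    (U.map (|·| ^ (a + 2))).sum * (U.map (|·| ^ (b + 2))).sum ≤
      (U.map (|·| ^ 2)).sum * (U.map (|·| ^ (a + b + 2))).sum := by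
  induction U using Multiset.induction with
  | empty => simp
  | cons x U ih =>
    simp only [Multiset.map_cons, Multiset.sum_cons]
    have h := mul_le_mul_of_nonneg_left (pow_mul_sum_add_le x U a b) (sq_nonneg |x|)
    have e1 : |x| ^ (a + 2) = |x| ^ 2 * |x| ^ a := by ring
    have e2 : |x| ^ (b + 2) = |x| ^ 2 * |x| ^ b := by ring
    have e3 : |x| ^ (a + b + 2) = |x| ^ 2 * |x| ^ (a + b) := by ring
    have e4 : |x| ^ (a + b) = |x| ^ a * |x| ^ b := by ring
    rw [e1, e2, e3, e4]
    rw [e4] at h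
    linarith

/-- The sum of the first `K` coefficients of the Edgeworth series for the power sums of `T`. -/
noncomputable def edgeworthSum (K : ℕ) (T : Multiset ℝ) : DiffSymbols :=
  ∑ c ∈ Finset.range K, coeff c (edgeworthSeries fun d => (T.map (· ^ d)).sum)

lemma edgeworthSum_zero {K : ℕ} (hK : 1 ≤ K) : edgeworthSum K 0 = 1 := by
  simp only [edgeworthSum, Multiset.map_zero, Multiset.sum_zero, edgeworthSeries_zero, coeff_one]
  rw [Finset.sum_ite_eq', if_pos (Finset.mem_range.2 (by omega))]

lemma edgeworthSum_cons (K : ℕ) (x : ℝ) (T : Multiset ℝ) : edgeworthSum K (x ::ₘ T) =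
    ∑ b ∈ Finset.range K, coeff b (edgeworthSeries fun d => x ^ d) * edgeworthSum (K - b) T := by
  have h : (edgeworthSeries fun d => ((x ::ₘ T).map (· ^ d)).sum) =
      edgeworthSeries (fun d => x ^ d) * edgeworthSeries fun d => (T.map (· ^ d)).sum := by
    rw [← edgeworthSeries_add]
    simp
  unfold edgeworthSum
  simp_rw [h, coeff_mul, Finset.Nat.sum_antidiagonal_eq_sum_range_succ_mk, Finset.mul_sum]
  exact Finset.sum_range_diag_flip K fun b c => coeff b (edgeworthSeries fun d => x ^ d) *
    coeff c (edgeworthSeries fun d => (T.map (· ^ d)).sum)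

/-- The expansion with remainder, with some of the arguments `U` (namely those not in `T`) already
replaced by their variance, and after the action of a monomial of order `a`. The induction on the
length `K` of the expansion and on `T` uses the multiplicativity of the Edgeworth series. -/
theorem exists_expansion_bound (K : ℕ) (hK : 1 ≤ K) : ∃ C : ℝ, 0 ≤ C ∧
    ∀ {s a : ℕ} {B : ℝ} {F : Multiset (ℕ × ℝ) → ℝ}, MarkedFamily s B F → 0 ≤ B → a + K + 2 = s →
      ∀ U : Multiset ℝ, (U.map (· ^ 2)).sum = 1 → ∀ T ≤ U, ∀ μ ∈ gradedExponents a,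
        |gaussEval F (1 - (T.map (· ^ 2)).sum) T (MvPolynomial.monomial μ 1) -
          gaussEval F 1 0 (MvPolynomial.monomial μ 1 * edgeworthSum K T)| ≤
            C * B * (U.map (|·| ^ (K + 2))).sum := by
  induction K using Nat.strong_induction_on with
  | _ K ih =>
  obtain ⟨K, rfl⟩ : ∃ K', K = K' + 1 := ⟨K - 1, by omega⟩
  have ih' : ∀ b : ℕ, ∃ C : ℝ, 0 ≤ C ∧ (b < K →
    ∀ {s a : ℕ} {B : ℝ} {F : Multiset (ℕ × ℝ) → ℝ}, MarkedFamily s B F → 0 ≤ B →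
      a + (K - b) + 2 = s → ∀ U : Multiset ℝ, (U.map (· ^ 2)).sum = 1 → ∀ T ≤ U,
      ∀ μ ∈ gradedExponents a,
        |gaussEval F (1 - (T.map (· ^ 2)).sum) T (MvPolynomial.monomial μ 1) -
          gaussEval F 1 0 (MvPolynomial.monomial μ 1 * edgeworthSum (K - b) T)| ≤
            C * B * (U.map (|·| ^ (K - b + 2))).sum) := by
    intro b
    by_cases hb : b < K
    · obtain ⟨C, hC, h⟩ := ih (K - b) (by omega) (by omega)
      exact ⟨C, hC, fun _ => h⟩
    · exact ⟨0, le_rfl, fun h => absurd h hb⟩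
  choose D hD0 hD using ih'
  set N : ℕ → ℝ := fun b => ∑ n ∈ Finset.range (b + 1 + 1), coeffNorm (edgeworthPart (b + 1) n) with hN
  have hN0 : ∀ b, 0 ≤ N b := fun b => Finset.sum_nonneg fun n _ => coeffNorm_nonneg _
  refine ⟨swapConst (K + 1) + ∑ b ∈ Finset.range K, N b * D b, add_nonneg (swapConst_nonneg _)
    (Finset.sum_nonneg fun b _ => mul_nonneg (hN0 b) (hD0 b)), ?_⟩
  intro s a B F hF hB hs U hU T hT μ hμ
  have hsq : ∀ V : Multiset ℝ, (V.map (|·| ^ 2)).sum = (V.map (· ^ 2)).sum := by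
    intro V; simp only [sq_abs]
  suffices h : ∀ T ≤ U, |gaussEval F (1 - (T.map (· ^ 2)).sum) T (MvPolynomial.monomial μ 1) -
          gaussEval F 1 0 (MvPolynomial.monomial μ 1 * edgeworthSum (K + 1) T)| ≤
        swapConst (K + 1) * B * (T.map (|·| ^ (K + 1 + 2))).sum +
          ∑ b ∈ Finset.range K, N b * D b * B *
            ((T.map (|·| ^ (b + 1 + 2))).sum * (U.map (|·| ^ (K - b + 2))).sum) by
    refine (h T hT).trans ?_
    rw [add_mul, add_mul, Finset.sum_mul, Finset.sum_mul]
    refine add_le_add (mul_le_mul_of_nonneg_left (sum_abs_pow_mono hT _)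
      (mul_nonneg (swapConst_nonneg _) hB)) (Finset.sum_le_sum fun b hb => ?_)
    rw [Finset.mem_range] at hb
    refine mul_le_mul_of_nonneg_left ?_ (mul_nonneg (mul_nonneg (hN0 b) (hD0 b)) hB)
    have h1 := sum_abs_pow_mul_le U (b + 1) (K - b)
    rw [hsq, hU, one_mul, show b + 1 + (K - b) + 2 = K + 1 + 2 by omega] at h1
    exact (mul_le_mul_of_nonneg_right (sum_abs_pow_mono hT _) (sum_abs_pow_nonneg _ _)).trans h1
  clear hT T
  intro T
  induction T using Multiset.induction with
  | empty =>
    intro _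
    simp [edgeworthSum_zero]
  | cons x T ihT =>
    intro hT
    have hT' : T ≤ U := (Multiset.le_cons_self T x).trans hT
    have hV : ((x ::ₘ T).map (· ^ 2)).sum ≤ 1 := by
      have := sum_abs_pow_mono hT 2
      rwa [hsq, hsq, hU] at this
    have hV0 := sum_sq_nonneg T
    rw [Multiset.map_cons, Multiset.sum_cons] at hV
    have hx : |x| ≤ 1 := by
      rw [← sq_le_one_iff_abs_le_one]; linarith
    have h1 := hF.abs_gaussEval_swap_le hB (K := K + 1) (by omega) hs hμ T hx
      (v := 1 - ((x ::ₘ T).map (· ^ 2)).sum)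
      (by rw [Multiset.map_cons, Multiset.sum_cons]; linarith)
    rw [show 1 - ((x ::ₘ T).map (· ^ 2)).sum + x ^ 2 = 1 - (T.map (· ^ 2)).sum by
      rw [Multiset.map_cons, Multiset.sum_cons]; ring] at h1
    have h2 := ihT hT'
    set v := 1 - (T.map (· ^ 2)).sum with hv
    have h3 : ∀ b ∈ Finset.range K,
        |gaussEval F v T (MvPolynomial.monomial μ 1 *
            coeff (b + 1) (edgeworthSeries fun d => x ^ d)) -
          gaussEval F 1 0 (MvPolynomial.monomial μ 1 *
            (coeff (b + 1) (edgeworthSeries fun d => x ^ d) * edgeworthSum (K - b) T))|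
        ≤ N b * D b * B * (|x| ^ (b + 1 + 2) * (U.map (|·| ^ (K - b + 2))).sum) := by
      intro b hb
      rw [Finset.mem_range] at hb
      set M := D b * B * (U.map (|·| ^ (K - b + 2))).sum with hM
      have hM0 : 0 ≤ M := mul_nonneg (mul_nonneg (hD0 b) hB) (sum_abs_pow_nonneg _ _)
      let Λ : DiffSymbols →ₗ[ℝ] ℝ :=
        gaussEval F v T ∘ₗ LinearMap.mulLeft ℝ (MvPolynomial.monomial μ 1) -
        gaussEval F 1 0 ∘ₗ LinearMap.mulLeft ℝ (MvPolynomial.monomial μ 1) ∘ₗ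
          LinearMap.mulRight ℝ (edgeworthSum (K - b) T)
      have hΛ : ∀ Q, Λ Q = gaussEval F v T (MvPolynomial.monomial μ 1 * Q) -
          gaussEval F 1 0 (MvPolynomial.monomial μ 1 * (Q * edgeworthSum (K - b) T)) :=
        fun Q => rfl
      have hΛ1 : ∀ ν ∈ gradedExponents (b + 1), |Λ (MvPolynomial.monomial ν 1)| ≤ M := by
        intro ν hν
        rw [hΛ, ← mul_assoc, MvPolynomial.monomial_mul, one_mul]
        exact hD b hb hF hB (by omega) U hU T hT' (μ + ν) (add_mem_gradedExponents hμ hν)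
      rw [← hΛ, coeff_edgeworthSeries_pow x (Nat.lt_succ_self (b + 1)), map_sum]
      refine (Finset.abs_sum_le_sum_abs _ _).trans ?_
      rw [show N b * D b * B * (|x| ^ (b + 1 + 2) * (U.map (|·| ^ (K - b + 2))).sum)
        = N b * (|x| ^ (b + 1 + 2) * M) by rw [hM]; ring, hN, Finset.sum_mul]
      refine Finset.sum_le_sum fun n _ => ?_
      rw [linearMap_C_mul, abs_mul, abs_pow]
      have h4 := abs_linearMap_le Λ (edgeworthPart_mem (b + 1) n) hΛ1
      have h5 := coeffNorm_nonneg (edgeworthPart (b + 1) n)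
      rcases Nat.eq_zero_or_pos n with rfl | hn
      · rw [edgeworthPart_zero_right (by omega), map_zero, abs_zero, mul_zero]
        simp [coeffNorm]
      · calc _ ≤ |x| ^ (b + 1 + 2) * (coeffNorm (edgeworthPart (b + 1) n) * M) :=
              mul_le_mul (pow_le_pow_of_le_one (abs_nonneg x) hx (by omega)) h4 (abs_nonneg _)
                (by positivity)
          _ = _ := by ring
    have h4 := (Finset.abs_sum_le_sum_abs _ _).trans (Finset.sum_le_sum h3)
    rw [Finset.sum_sub_distrib] at h4
    have e1 : gaussEval F v T (MvPolynomial.monomial μ 1 *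
        ∑ b ∈ Finset.range (K + 1), coeff b (edgeworthSeries fun d => x ^ d)) =
        ∑ b ∈ Finset.range K, gaussEval F v T (MvPolynomial.monomial μ 1 *
          coeff (b + 1) (edgeworthSeries fun d => x ^ d)) +
        gaussEval F v T (MvPolynomial.monomial μ 1) := by
      rw [Finset.sum_range_succ', coeff_zero_edgeworthSeries, mul_add, mul_one, map_add,
        Finset.mul_sum, map_sum]
    have e2 : gaussEval F 1 0 (MvPolynomial.monomial μ 1 * edgeworthSum (K + 1) (x ::ₘ T)) =
        ∑ b ∈ Finset.range K, gaussEval F 1 0 (MvPolynomial.monomial μ 1 *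
          (coeff (b + 1) (edgeworthSeries fun d => x ^ d) * edgeworthSum (K - b) T)) +
        gaussEval F 1 0 (MvPolynomial.monomial μ 1 * edgeworthSum (K + 1) T) := by
      rw [edgeworthSum_cons, Finset.sum_range_succ', coeff_zero_edgeworthSeries, mul_add, one_mul,
        map_add, Finset.mul_sum, map_sum]
      simp only [Nat.add_sub_add_right, Nat.sub_zero]
    rw [e1] at h1
    rw [e2]
    have e3 : ∑ b ∈ Finset.range K, N b * D b * B *
            (((x ::ₘ T).map (|·| ^ (b + 1 + 2))).sum * (U.map (|·| ^ (K - b + 2))).sum) =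
        ∑ b ∈ Finset.range K, N b * D b * B *
            (|x| ^ (b + 1 + 2) * (U.map (|·| ^ (K - b + 2))).sum) +
        ∑ b ∈ Finset.range K, N b * D b * B *
            ((T.map (|·| ^ (b + 1 + 2))).sum * (U.map (|·| ^ (K - b + 2))).sum) := by
      rw [← Finset.sum_add_distrib]
      refine Finset.sum_congr rfl fun b _ => ?_
      rw [Multiset.map_cons, Multiset.sum_cons]
      ring
    rw [e3]
    simp only [Multiset.map_cons, Multiset.sum_cons] at h1 ⊢
    rw [abs_le] at *
    constructor <;> linarith

end SymmExpansion

namespace SymmExpansion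

open Filter Topology

/-! ### Iterated partial derivatives -/

/-- Iterated partial derivatives are characterized by their differential relations: a family `G β` in
which `G (β + eᵢ)` is the `i`-th partial derivative of `G β` consists of the derivatives of `G 0`. -/
lemma mixedPartial_eq_of_hasDerivAt {n : ℕ} {A : Set (Fin n → ℕ)} (hA : IsLowerSet A)
    {G : (Fin n → ℕ) → (Fin n → ℝ) → ℝ}
    (hG : ∀ β i, β + Pi.single i 1 ∈ A → ∀ x, HasDerivAt (fun t => G β (Function.update x i t))
      (G (β + Pi.single i 1) x) (x i)) {β : Fin n → ℕ} (hβ : β ∈ A) :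
    mixedPartial β (G 0) = G β := by
  have hstep : ∀ (i : Fin n) (c : ℕ) (γ : Fin n → ℕ), γ + Pi.single i c ∈ A →
      (partialDeriv i)^[c] (G γ) = G (γ + Pi.single i c) := by
    intro i c
    induction c with
    | zero => intro γ _; simp
    | succ c ih =>
      intro γ h
      have e : γ + Pi.single i (c + 1) = γ + Pi.single i c + Pi.single i 1 := by
        rw [add_assoc, ← Pi.single_add]
      rw [e] at h ⊢
      rw [Function.iterate_succ_apply', ih γ (hA (by simp) h)]
      funext x
      exact (hG _ i h x).deriv
  have hlist : ∀ L : List (Fin n), L.Nodup →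
      L.foldr (fun i g => (partialDeriv i)^[β i] g) (G 0) = G fun j => if j ∈ L then β j else 0 := by
    intro L hL
    induction L with
    | nil => rfl
    | cons i L ih =>
      rw [List.nodup_cons] at hL
      have e : (fun j => if j ∈ i :: L then β j else 0) =
          (fun j => if j ∈ L then β j else 0) + Pi.single i (β i) := by
        funext j
        rw [Pi.add_apply]
        by_cases hj : j = i
        · subst hj; simp [hL.1]
        · simp [hj]
      rw [List.foldr_cons, ih hL.2, hstep, ← e]
      rw [← e]
      exact hA (fun j => by simp only; split_ifs <;> simp) hβ
  rw [mixedPartial, hlist _ (List.nodup_finRange n)]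
  simp

lemma hasMixedPartials_of_hasDerivAt {n : ℕ} {A : Set (Fin n → ℕ)} (hA : IsLowerSet A)
    {G : (Fin n → ℕ) → (Fin n → ℝ) → ℝ}
    (hG : ∀ β i, β + Pi.single i 1 ∈ A → ∀ x, HasDerivAt (fun t => G β (Function.update x i t))
      (G (β + Pi.single i 1) x) (x i)) : HasMixedPartials A (G 0) := by
  intro β i hβ hβi x
  rw [mixedPartial_eq_of_hasDerivAt hA hG hβ, mixedPartial_eq_of_hasDerivAt hA hG hβi]
  exact hG β i hβi x

lemma mixedPartial_zero {n : ℕ} (f : (Fin n → ℝ) → ℝ) : mixedPartial 0 f = f := by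
  have : ∀ L : List (Fin n),
      L.foldr (fun i g => (partialDeriv i)^[(0 : Fin n → ℕ) i] g) f = f := by
    intro L
    induction L with
    | nil => rfl
    | cons i L ih => rw [List.foldr_cons, ih]; rfl
  exact this _

lemma isLowerSet_belowAdmissible (s n : ℕ) : IsLowerSet (belowAdmissible s n) := by
  rintro β γ h ⟨h1, h2⟩
  refine ⟨(Finset.card_le_card fun i hi => ?_).trans h1,
    (Finset.sum_le_sum fun i _ => Nat.sub_le_sub_right (h i) 2).trans h2⟩
  simp only [active, Finset.mem_filter, Finset.mem_univ, true_and] at hi ⊢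
  have : γ i ≤ β i := h i
  omega

lemma mem_belowAdmissible_comp_perm {s n : ℕ} {β : Fin n → ℕ} (σ : Equiv.Perm (Fin n)) :
    (fun i => β (σ i)) ∈ belowAdmissible s n ↔ β ∈ belowAdmissible s n := by
  have h1 : (active fun i => β (σ i)).card = (active β).card := by
    refine Finset.card_bij (fun i _ => σ i) ?_ ?_ ?_
    · intro i hi; simpa [active] using hi
    · intro i _ j _ h; exact σ.injective h
    · intro j hj
      exact ⟨σ.symm j, by simpa [active] using hj, by simp⟩
  have h2 : ∑ i, (β (σ i) - 2) = ∑ i, (β i - 2) := Equiv.sum_comp σ fun i => β i - 2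
  simp only [belowAdmissible, Set.mem_ofPred_eq, h1, h2]

lemma mixedPartial_comp_perm {s n : ℕ} {f : (Fin n → ℝ) → ℝ}
    (hf : HasMixedPartials (belowAdmissible s n) f)
    (hsymm : ∀ (σ : Equiv.Perm (Fin n)) (x : Fin n → ℝ), f (fun i => x (σ i)) = f x)
    (σ : Equiv.Perm (Fin n)) {β : Fin n → ℕ} (hβ : β ∈ belowAdmissible s n) (x : Fin n → ℝ) :
    mixedPartial (fun i => β (σ i)) f (fun i => x (σ i)) = mixedPartial β f x := by
  have h := mixedPartial_eq_of_hasDerivAt (isLowerSet_belowAdmissible s n)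
    (G := fun β x => mixedPartial (fun i => β (σ i)) f (fun i => x (σ i))) ?_ hβ
  · have h0 : (fun x : Fin n → ℝ => mixedPartial (fun i => (0 : Fin n → ℕ) (σ i)) f
        (fun i => x (σ i))) = f := by
      funext y
      exact (congrFun (mixedPartial_zero f) _).trans (hsymm σ y)
    simp only [h0] at h
    exact (congrFun h x).symm
  · intro β i hβi x
    have e1 : (fun j => (β + Pi.single i 1 : Fin n → ℕ) (σ j)) =
        (fun j => β (σ j)) + Pi.single (σ.symm i) 1 := by
      funext j
      simp only [Pi.add_apply, Pi.single_apply, Equiv.eq_symm_apply]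
    have e2 : ∀ t, (fun j => Function.update x i t (σ j)) =
        Function.update (fun j => x (σ j)) (σ.symm i) t := by
      intro t
      funext j
      simp only [Function.update_apply, Equiv.eq_symm_apply]
    have hb : β ∈ belowAdmissible s n := isLowerSet_belowAdmissible s n (by simp) hβi
    have := hf (fun j => β (σ j)) (σ.symm i) ((mem_belowAdmissible_comp_perm σ).2 hb)
      (by rw [← e1]; exact (mem_belowAdmissible_comp_perm σ).2 hβi) (fun j => x (σ j))
    simp only [e1, e2]
    simpa using this

lemma cons_zero_mem_belowAdmissible {s n : ℕ} {β : Fin n → ℕ} :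
    (Fin.cons 0 β : Fin (n + 1) → ℕ) ∈ belowAdmissible s (n + 1) ↔ β ∈ belowAdmissible s n := by
  have h1 : (active (Fin.cons 0 β : Fin (n + 1) → ℕ)).card = (active β).card := by
    simp only [active, Finset.card_filter, Fin.sum_univ_succ, Fin.cons_zero, Fin.cons_succ]
    simp
  simp only [belowAdmissible, Set.mem_ofPred_eq, h1, Fin.sum_univ_succ, Fin.cons_zero, Fin.cons_succ,
    zero_tsub, zero_add]

lemma mixedPartial_cons_zero {s n : ℕ} {f : (Fin n → ℝ) → ℝ} {g : (Fin (n + 1) → ℝ) → ℝ}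
    (hg : HasMixedPartials (belowAdmissible s (n + 1)) g)
    (hfg : ∀ x : Fin n → ℝ, g (Fin.cons 0 x) = f x)
    {β : Fin n → ℕ} (hβ : β ∈ belowAdmissible s n) (x : Fin n → ℝ) :
    mixedPartial (Fin.cons 0 β) g (Fin.cons 0 x) = mixedPartial β f x := by
  have h := mixedPartial_eq_of_hasDerivAt (isLowerSet_belowAdmissible s n)
    (G := fun β x => mixedPartial (Fin.cons 0 β) g (Fin.cons 0 x)) ?_ hβ
  · have h0 : (fun x : Fin n → ℝ => mixedPartial (Fin.cons 0 (0 : Fin n → ℕ)) g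
        (Fin.cons 0 x)) = f := by
      funext y
      have e : (Fin.cons 0 (0 : Fin n → ℕ) : Fin (n + 1) → ℕ) = 0 := by
        funext i; refine Fin.cases ?_ (fun i => ?_) i <;> simp
      rw [e, mixedPartial_zero, hfg]
    simp only [h0] at h
    exact (congrFun h x).symm
  · intro β i hβi x
    have e1 : (Fin.cons 0 (β + Pi.single i 1) : Fin (n + 1) → ℕ) =
        Fin.cons 0 β + Pi.single i.succ 1 := by
      funext j
      refine Fin.cases ?_ (fun j => ?_) j
      · simp
      · simp [Pi.single_apply]
    have hb : β ∈ belowAdmissible s n := isLowerSet_belowAdmissible s n (by simp) hβi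
    have := hg (Fin.cons 0 β) i.succ (cons_zero_mem_belowAdmissible.2 hb)
      (by rw [← e1]; exact cons_zero_mem_belowAdmissible.2 hβi) (Fin.cons 0 x)
    simp only [e1, Fin.cons_update]
    simpa using this

/-! ### From functions to marked families -/

lemma exists_fin_map_eq {α : Type*} (m : Multiset α) :
    ∃ (n : ℕ) (f : Fin n → α), Finset.univ.val.map f = m := by
  obtain ⟨l, rfl⟩ := Quot.exists_rep m
  exact ⟨l.length, l.get, (Fin.univ_val_map _).trans (congrArg _ (List.ofFn_get l))⟩

lemma exists_perm_of_map_eq {α : Type*} {n : ℕ} {f g : Fin n → α}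
    (h : Finset.univ.val.map f = Finset.univ.val.map g) :
    ∃ σ : Equiv.Perm (Fin n), ∀ i, g (σ i) = f i := by
  classical
  have hc : ∀ a, Fintype.card {i // f i = a} = Fintype.card {i // g i = a} := by
    intro a
    have := congrArg (Multiset.count a) h
    rw [Multiset.count_map, Multiset.count_map] at this
    rw [Fintype.card_subtype, Fintype.card_subtype]
    simp only [eq_comm (a := a)] at this
    exact this
  refine ⟨Equiv.ofFiberEquiv fun a => Fintype.equivOfCardEq (hc a), fun i => ?_⟩
  exact Equiv.ofFiberEquiv_map _ i

lemma map_cons_eq {α : Type*} {n : ℕ} (a : α) (f : Fin n → α) :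
    Finset.univ.val.map (Fin.cons a f : Fin (n + 1) → α) = a ::ₘ Finset.univ.val.map f := by
  simp [Fin.univ_val_map, List.ofFn_succ]

/-- The derivative of `h n` prescribed by a family of `n` marks. -/
noncomputable def derivAtMarks (h : (n : ℕ) → (Fin n → ℝ) → ℝ) {n : ℕ} (f : Fin n → ℕ × ℝ) : ℝ :=
  mixedPartial (fun i => (f i).1) (h n) (fun i => (f i).2)

/-- The function of configurations of marks given by the derivatives of all the `h n`. An additional
mark `(0, 0)` avoids the use of `h 0`, on which no assumption is made. -/
noncomputable def ofMarks (h : (n : ℕ) → (Fin n → ℝ) → ℝ) (m : Multiset (ℕ × ℝ)) : ℝ :=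
  derivAtMarks h (exists_fin_map_eq ((0, 0) ::ₘ m)).choose_spec.choose

lemma mem_belowAdmissible_iff {s n : ℕ} (f : Fin n → ℕ × ℝ) :
    (fun i => (f i).1) ∈ belowAdmissible s n ↔ activeCard (Finset.univ.val.map f) ≤ s ∧
      excess (Finset.univ.val.map f) ≤ s - 2 := by
  simp only [belowAdmissible, Set.mem_ofPred_eq, activeCard, excess, Multiset.countP_map,
    Multiset.map_map]
  rfl

section

variable {s : ℕ} {h : (n : ℕ) → (Fin n → ℝ) → ℝ}

lemma derivAtMarks_congr (hsymm : Symmetric h)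
    (hpart : ∀ n, 1 ≤ n → HasMixedPartials (belowAdmissible s n) (h n)) {n n' : ℕ} (hn : 1 ≤ n)
    {f : Fin n → ℕ × ℝ} {g : Fin n' → ℕ × ℝ}
    (hfg : Finset.univ.val.map f = Finset.univ.val.map g)
    (hc : activeCard (Finset.univ.val.map f) ≤ s) (he : excess (Finset.univ.val.map f) ≤ s - 2) :
    derivAtMarks h f = derivAtMarks h g := by
  obtain rfl : n = n' := by simpa using congrArg Multiset.card hfg
  obtain ⟨σ, hσ⟩ := exists_perm_of_map_eq hfg
  obtain rfl : f = fun i => g (σ i) := funext fun i => (hσ i).symm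
  rw [hfg] at hc he
  exact mixedPartial_comp_perm (hpart n hn) (hsymm n hn) σ ((mem_belowAdmissible_iff g).2 ⟨hc, he⟩)
    fun i => (g i).2

lemma ofMarks_eq_of_map_eq_cons (hsymm : Symmetric h)
    (hpart : ∀ n, 1 ≤ n → HasMixedPartials (belowAdmissible s n) (h n)) {n : ℕ}
    {f : Fin n → ℕ × ℝ} {m : Multiset (ℕ × ℝ)} (hf : Finset.univ.val.map f = (0, 0) ::ₘ m)
    (hc : activeCard m ≤ s) (he : excess m ≤ s - 2) : ofMarks h m = derivAtMarks h f := by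
  have hn : 1 ≤ n := by
    have := congrArg Multiset.card hf
    simp at this
    omega
  refine (derivAtMarks_congr hsymm hpart hn ?_ (by simpa [hf] using hc) (by simpa [hf] using he)).symm
  rw [hf]
  exact (exists_fin_map_eq ((0, 0) ::ₘ m)).choose_spec.choose_spec.symm

lemma ofMarks_map (hcons : Consistent h) (hsymm : Symmetric h)
    (hpart : ∀ n, 1 ≤ n → HasMixedPartials (belowAdmissible s n) (h n)) {n : ℕ} (hn : 1 ≤ n)
    (f : Fin n → ℕ × ℝ) (hc : activeCard (Finset.univ.val.map f) ≤ s)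
    (he : excess (Finset.univ.val.map f) ≤ s - 2) :
    ofMarks h (Finset.univ.val.map f) = derivAtMarks h f := by
  rw [ofMarks_eq_of_map_eq_cons hsymm hpart (map_cons_eq (0, 0) f) hc he]
  have := mixedPartial_cons_zero (f := h n) (hpart (n + 1) (by omega))
    (fun x => by rw [← hcons n hn 0 x, Fin.insertNth_zero']) ((mem_belowAdmissible_iff f).2 ⟨hc, he⟩)
    (fun i => (f i).2)
  rw [derivAtMarks, derivAtMarks, ← this]
  congr 1
  · funext i; refine Fin.cases ?_ (fun i => ?_) i <;> simp
  · funext i; refine Fin.cases ?_ (fun i => ?_) i <;> simp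

lemma ofMarks_cons (hcons : Consistent h) (hsymm : Symmetric h)
    (hpart : ∀ n, 1 ≤ n → HasMixedPartials (belowAdmissible s n) (h n)) {n : ℕ} (p : ℕ) (u : ℝ)
    (f : Fin n → ℕ × ℝ) (hc : activeCard ((p, u) ::ₘ Finset.univ.val.map f) ≤ s)
    (he : excess ((p, u) ::ₘ Finset.univ.val.map f) ≤ s - 2) :
    ofMarks h ((p, u) ::ₘ Finset.univ.val.map f) =
      mixedPartial (Fin.cons p fun i => (f i).1) (h (n + 1)) (Fin.cons u fun i => (f i).2) := by
  rw [← map_cons_eq] at hc he ⊢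
  rw [ofMarks_map hcons hsymm hpart (by omega) _ hc he, derivAtMarks]
  congr 1
  · funext i; refine Fin.cases ?_ (fun i => ?_) i <;> simp
  · funext i; refine Fin.cases ?_ (fun i => ?_) i <;> simp

lemma hasDerivAt_ofMarks (hcons : Consistent h) (hsymm : Symmetric h)
    (hpart : ∀ n, 1 ≤ n → HasMixedPartials (belowAdmissible s n) (h n)) (p : ℕ) (t : ℝ)
    (m : Multiset (ℕ × ℝ)) (hc : activeCard m + 1 ≤ s) (he : excess m + (p + 1 - 2) ≤ s - 2) :
    HasDerivAt (fun u => ofMarks h ((p, u) ::ₘ m)) (ofMarks h ((p + 1, t) ::ₘ m)) t := by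
  obtain ⟨n, f, rfl⟩ := exists_fin_map_eq m
  have hc1 : ∀ q u, activeCard ((q, u) ::ₘ Finset.univ.val.map f) ≤ s := by
    intro q u; simp only [activeCard_cons]; split_ifs <;> omega
  have he1 : ∀ u, excess ((p, u) ::ₘ Finset.univ.val.map f) ≤ s - 2 := by
    intro u; simp only [excess_cons]; omega
  have he2 : excess ((p + 1, t) ::ₘ Finset.univ.val.map f) ≤ s - 2 := by
    simp only [excess_cons]; omega
  simp_rw [fun u => ofMarks_cons hcons hsymm hpart p u f (hc1 p u) (he1 u)]
  rw [ofMarks_cons hcons hsymm hpart (p + 1) t f (hc1 _ _) he2]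
  have e : (Fin.cons p (fun i => (f i).1) : Fin (_ + 1) → ℕ) + Pi.single 0 1 =
      Fin.cons (p + 1) (fun i => (f i).1) := by
    funext i; refine Fin.cases ?_ (fun i => ?_) i <;> simp
  have hb : ∀ q u, excess ((q, u) ::ₘ Finset.univ.val.map f) ≤ s - 2 →
      (Fin.cons q fun i => (f i).1 : Fin (_ + 1) → ℕ) ∈ belowAdmissible s _ := by
    intro q u hq
    have := (mem_belowAdmissible_iff (s := s) (Fin.cons (q, u) f : Fin (_ + 1) → ℕ × ℝ)).2
      (by rw [map_cons_eq]; exact ⟨hc1 q u, hq⟩)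
    convert this using 1
    funext i; refine Fin.cases ?_ (fun i => ?_) i <;> simp
  have := hpart _ (by omega) (Fin.cons p fun i => (f i).1) 0 (hb p 0 (he1 0))
    (by rw [e]; exact hb (p + 1) t he2) (Fin.cons t fun i => (f i).2)
  rw [e] at this
  simpa using this

/-- Vanishing of the first derivative at zero persists under differentiation in the other
arguments. -/
lemma ofMarks_one_zero (hcons : Consistent h) (hvan : VanishingDeriv h) (hsymm : Symmetric h)
    (hpart : ∀ n, 1 ≤ n → HasMixedPartials (belowAdmissible s n) (h n))
    (m : Multiset (ℕ × ℝ)) (hc : activeCard m + 1 ≤ s) (he : excess m ≤ s - 2) :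
    ofMarks h ((1, 0) ::ₘ m) = 0 := by
  induction hN : (m.map Prod.fst).sum generalizing m with
  | zero =>
    have hd := hasDerivAt_ofMarks hcons hsymm hpart 0 0 m hc (by simpa using he)
    refine hd.unique ?_
    obtain ⟨n, f, rfl⟩ := exists_fin_map_eq m
    have hf : ∀ i, (f i).1 = 0 := by
      intro i
      refine Multiset.sum_eq_zero_iff.1 hN _ ?_
      rw [Multiset.map_map]
      exact Multiset.mem_map.2 ⟨i, Finset.mem_univ i, rfl⟩
    have hz : (Fin.cons 0 fun i => (f i).1 : Fin (_ + 1) → ℕ) = 0 := by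
      funext i; refine Fin.cases ?_ (fun i => ?_) i <;> simp [hf]
    have e : ∀ u, ofMarks h ((0, u) ::ₘ Finset.univ.val.map f) =
        h _ (Function.update (Fin.cons 0 fun i => (f i).2) 0 u) := by
      intro u
      rw [ofMarks_cons hcons hsymm hpart 0 u f (by rw [activeCard_cons, if_pos rfl]; omega)
        (by rwa [excess_cons]), hz,
        mixedPartial_zero, Fin.update_cons_zero]
    simp_rw [e]
    exact hvan _ (by omega) 0 _
  | succ N ih =>
    obtain ⟨⟨p, t⟩, hq, hp⟩ : ∃ q ∈ m, q.1 ≠ 0 := by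
      by_contra! hcon
      rw [Multiset.sum_eq_zero] at hN
      · omega
      · intro x hx
        obtain ⟨q, hq, rfl⟩ := Multiset.mem_map.1 hx
        exact hcon q hq
    obtain ⟨m, rfl⟩ := Multiset.exists_cons_of_mem hq
    obtain ⟨p, rfl⟩ : ∃ p', p = p' + 1 := ⟨p - 1, by simp at hp; omega⟩
    simp only [activeCard_cons, excess_cons, Multiset.map_cons, Multiset.sum_cons, Nat.succ_ne_zero,
      if_false] at hc he hN
    have hd := hasDerivAt_ofMarks hcons hsymm hpart p t ((1, 0) ::ₘ m) (by simp; omega)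
      (by simp; omega)
    have hz : ∀ u, ofMarks h ((p, u) ::ₘ (1, 0) ::ₘ m) = 0 := by
      intro u
      rw [Multiset.cons_swap]
      refine ih ((p, u) ::ₘ m) ?_ ?_ ?_
      · simp only [activeCard_cons]; split_ifs <;> omega
      · simp only [excess_cons]; omega
      · simp only [Multiset.map_cons, Multiset.sum_cons]; omega
    simp_rw [hz] at hd
    rw [Multiset.cons_swap]
    exact hd.unique (hasDerivAt_const t 0)

lemma markedFamily_ofMarks {B : ℝ} (hcons : Consistent h) (hvan : VanishingDeriv h)
    (hsymm : Symmetric h) (hpart : ∀ n, 1 ≤ n → HasMixedPartials (belowAdmissible s n) (h n))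
    (hbound : ∀ n, 1 ≤ n → ∀ α : Fin n → ℕ, Admissible s α →
      ∀ ε : Fin n → ℝ, |mixedPartial α (h n) ε| ≤ B) : MarkedFamily s B (ofMarks h) where
  zero_mark m hc he := by
    obtain ⟨n, f, rfl⟩ := exists_fin_map_eq m
    rw [ofMarks_eq_of_map_eq_cons hsymm hpart (map_cons_eq (0, 0) f) hc he, ← map_cons_eq]
    exact ofMarks_map hcons hsymm hpart (by omega) _ (by rwa [map_cons_eq, activeCard_cons])
      (by rwa [map_cons_eq, excess_cons])
  hasDerivAt p t m hc he := hasDerivAt_ofMarks hcons hsymm hpart p t m hc he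
  one_mark m hc he := ofMarks_one_zero hcons hvan hsymm hpart m hc he
  bound m hc he hone hne := by
    obtain ⟨n, f, hf⟩ := exists_fin_map_eq m
    have hmem : ∀ i, f i ∈ m := fun i => by
      rw [← hf]; exact Multiset.mem_map.2 ⟨i, Finset.mem_univ i, rfl⟩
    obtain ⟨q, hq, hq0⟩ := hne
    have hn : 1 ≤ n := by
      have := Multiset.card_pos_iff_exists_mem.2 ⟨q, hq⟩
      rw [← hf] at this
      simpa [Nat.one_le_iff_ne_zero, Nat.pos_iff_ne_zero] using this
    have hb := (mem_belowAdmissible_iff (s := s) f).2 (by rw [hf]; exact ⟨hc, he⟩)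
    have e : ofMarks h m = derivAtMarks h f := by
      conv_lhs => rw [← hf]
      exact ofMarks_map hcons hsymm hpart hn f (by rwa [hf]) (by rwa [hf])
    rw [e]
    refine hbound _ hn _ ⟨?_, hb.1, ?_, ?_⟩ _
    · intro h0
      rw [← hf] at hq
      obtain ⟨i, -, rfl⟩ := Multiset.mem_map.1 hq
      exact hq0 (congrFun h0 i)
    · intro i hi
      simp only [active, Finset.mem_filter, Finset.mem_univ, true_and] at hi
      have := hone _ (hmem i)
      omega
    · exact (Finset.sum_le_sum_of_subset (Finset.subset_univ _)).trans hb.2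

end

end SymmExpansion

namespace SymmExpansion

open Filter Topology

/-! ### The limit functions -/

/-- The configuration of `n` marks with orders `β` and positions `x`. -/
def finMarks {n : ℕ} (β : Fin n → ℕ) (x : Fin n → ℝ) : Multiset (ℕ × ℝ) :=
  Finset.univ.val.map fun i => (β i, x i)

/-- The limit functions `h_∞(λ₁, …, λ_l, ρ)`. -/
noncomputable def limitFunction (h : (n : ℕ) → (Fin n → ℝ) → ℝ) (l : ℕ) (lam : Fin l → ℝ) (ρ : ℝ) :
    ℝ :=
  gaussLim (ofMarks h) ρ (finMarks 0 lam)

lemma activeCard_finMarks_zero {n : ℕ} (x : Fin n → ℝ) : activeCard (finMarks 0 x) = 0 := by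
  rw [activeCard, Multiset.countP_eq_zero]
  intro q hq
  obtain ⟨i, -, rfl⟩ := Multiset.mem_map.1 hq
  simp

lemma excess_finMarks {n : ℕ} (β : Fin n → ℕ) (x : Fin n → ℝ) :
    excess (finMarks β x) = ∑ i, (β i - 2) := by
  rw [excess, finMarks, Multiset.map_map]
  rfl

lemma finMarks_eq_cons {n : ℕ} (β : Fin n → ℕ) (x : Fin n → ℝ) (i : Fin n) :
    finMarks β x = (β i, x i) ::ₘ (Finset.univ.erase i).val.map fun j => (β j, x j) := by
  rw [finMarks, ← Finset.insert_erase (Finset.mem_univ i),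
    Finset.insert_val_of_notMem (Finset.notMem_erase i _), Multiset.map_cons]
  simp

section

variable {s : ℕ} {h : (n : ℕ) → (Fin n → ℝ) → ℝ}

lemma ofMarks_finMarks_zero (hcons : Consistent h) (hsymm : Symmetric h)
    (hpart : ∀ n, 1 ≤ n → HasMixedPartials (belowAdmissible s n) (h n)) {n : ℕ} (hn : 1 ≤ n)
    (x : Fin n → ℝ) : ofMarks h (finMarks 0 x) = h n x := by
  have hc := activeCard_finMarks_zero x
  have he := excess_finMarks 0 x
  simp only [Pi.zero_apply, zero_tsub, Finset.sum_const_zero] at he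
  have := ofMarks_map hcons hsymm hpart hn (fun i => (0, x i))
    (hc.le.trans (Nat.zero_le _))
    (he.le.trans (Nat.zero_le _))
  refine this.trans ?_
  exact congrFun (mixedPartial_zero (h n)) x

lemma isLimitFunction_limitFunction {B : ℝ} (hs : 3 ≤ s) (hB : 0 ≤ B) (hcons : Consistent h)
    (hsymm : Symmetric h)
    (hpart : ∀ n, 1 ≤ n → HasMixedPartials (belowAdmissible s n) (h n))
    (hF : MarkedFamily s B (ofMarks h)) : IsLimitFunction h (limitFunction h) := by
  intro l lam ρ
  have h1 := hF.tendsto_gaussLim hB ρ (finMarks 0 lam)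
    (by rw [activeCard_finMarks_zero]; omega) (by rw [excess_finMarks]; simp; omega)
  refine h1.congr' ?_
  filter_upwards [eventually_ge_atTop 1] with k hk
  rw [← ofMarks_finMarks_zero hcons hsymm hpart (by omega)]
  congr 1
  have e : ∀ {n : ℕ} (y : Fin n → ℝ), finMarks 0 y = points (List.ofFn y : Multiset ℝ) := by
    intro n y
    rw [finMarks, points, ← Fin.univ_val_map, Multiset.map_map]
    rfl
  rw [e, e, List.ofFn_fin_append, ← points_add, List.ofFn_const, ← Multiset.coe_replicate,
    add_comm, Multiset.coe_add]

lemma hasDerivAt_gaussLim_finMarks {B : ℝ} {F : Multiset (ℕ × ℝ) → ℝ} (hF : MarkedFamily s B F)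
    (hB : 0 ≤ B) (ρ : ℝ) {l : ℕ} (hl : l + 3 ≤ s) (β : Fin l → ℕ) (i : Fin l)
    (hβ : ∑ j, ((β + Pi.single i 1 : Fin l → ℕ) j - 2) ≤ l) (x : Fin l → ℝ) :
    HasDerivAt (fun t => gaussLim F ρ (finMarks β (Function.update x i t)))
      (gaussLim F ρ (finMarks (β + Pi.single i 1) x)) (x i) := by
  set m : Multiset (ℕ × ℝ) := (Finset.univ.erase i).val.map fun j => (β j, x j) with hm
  have e1 : ∀ t, finMarks β (Function.update x i t) = (β i, t) ::ₘ m := by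
    intro t
    rw [finMarks_eq_cons _ _ i, Function.update_self]
    congr 1
    refine Multiset.map_congr rfl fun j hj => ?_
    rw [Function.update_of_ne (Finset.ne_of_mem_erase (show j ∈ Finset.univ.erase i from hj))]
  have e2 : finMarks (β + Pi.single i 1) x = (β i + 1, x i) ::ₘ m := by
    rw [finMarks_eq_cons _ _ i, Pi.add_apply, Pi.single_eq_same]
    congr 1
    refine Multiset.map_congr rfl fun j hj => ?_
    rw [Pi.add_apply, Pi.single_eq_of_ne (Finset.ne_of_mem_erase (show j ∈ Finset.univ.erase i from hj)), add_zero]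
  have hc : activeCard m ≤ l := by
    refine (Multiset.countP_le_card _ _).trans ?_
    rw [hm, Multiset.card_map, Finset.card_val]
    exact (Finset.card_le_univ _).trans (Fintype.card_fin l).le
  have he := excess_finMarks (β + Pi.single i 1) x
  rw [e2, excess_cons] at he
  simp only at he
  simp_rw [e1]
  rw [e2]
  exact hF.hasDerivAt_gaussLim hB ρ (β i) (x i) m (by omega) (by omega)

lemma isLowerSet_sum_sub_two_le (l : ℕ) : IsLowerSet {β : Fin l → ℕ | ∑ i, (β i - 2) ≤ l} :=
  fun _ _ h hβ => (Finset.sum_le_sum fun i _ => Nat.sub_le_sub_right (h i) 2).trans hβ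

/-- The multi-index `orders l μ` consists of the factors of the monomial, padded by zeros. -/
lemma finMarks_orders {l : ℕ} {μ : ℕ →₀ ℕ} (hμ : (Finsupp.toMultiset μ).card ≤ l) :
    finMarks (orders l μ) 0 = Multiset.replicate (l - (Finsupp.toMultiset μ).card) (0, 0) +
      symbolMarks μ := by
  set L := (Finsupp.toMultiset μ).sort (fun a b => b ≤ a) with hL
  have hLm : (L : Multiset ℕ) = Finsupp.toMultiset μ := Multiset.sort_eq _ _
  have hlen : L.length = (Finsupp.toMultiset μ).card := by rw [← hLm]; rfl
  have h1 : List.ofFn (orders l μ) = L ++ List.replicate (l - L.length) 0 := by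
    refine List.ext_getElem (by simp; omega) fun i h1 h2 => ?_
    rw [List.getElem_ofFn, List.getElem_append, orders]
    split_ifs with hi
    · simp [← hL, hi]
    · simp only [← hL, List.getElem_replicate]
      exact List.getD_eq_default _ _ (by simpa using hi)
  have h2 : finMarks (orders l μ) 0 =
      (List.ofFn (orders l μ) : Multiset ℕ).map fun p => (p, (0 : ℝ)) := by
    rw [finMarks, ← Fin.univ_val_map, Multiset.map_map]
    rfl
  rw [h2, h1, ← Multiset.coe_add, Multiset.map_add, hLm, hlen, Multiset.coe_replicate,
    Multiset.map_replicate, symbolMarks, add_comm]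

lemma gaussLim_replicate_zero {B : ℝ} {F : Multiset (ℕ × ℝ) → ℝ} (hF : MarkedFamily s B F)
    (ρ : ℝ) (n : ℕ) (m : Multiset (ℕ × ℝ)) (hc : activeCard m ≤ s) (he : excess m ≤ s - 2) :
    gaussLim F ρ (Multiset.replicate n (0, 0) + m) = gaussLim F ρ m := by
  have hz : ∀ n, Multiset.replicate n ((0 : ℕ), (0 : ℝ)) = points (Multiset.replicate n 0) := by
    intro n; simp [points]
  induction n with
  | zero => simp
  | succ n ih =>
    rw [Multiset.replicate_succ, Multiset.cons_add, hF.gaussLim_zero_mark, ih]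
    · simpa [hz] using hc
    · simpa [hz] using he

/-- On the polynomials that occur in the expansion, `applyAtZero` agrees with the abstract action: the
derivatives of the limit function are the limits of the derivatives. -/
lemma applyAtZero_limitFunction {B : ℝ} (hB : 0 ≤ B) (hF : MarkedFamily s B (ofMarks h))
    {l : ℕ} (hl : l + 3 ≤ s) {Q : DiffSymbols} (hQ : Q ∈ gradedSymbols l) :
    applyAtZero Q (fun lam : Fin l → ℝ => limitFunction h l lam 1) =
      gaussEval (ofMarks h) 1 0 Q := by
  rw [linearMap_eq_sum, applyAtZero]
  refine Finset.sum_congr rfl fun μ hμ => ?_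
  have hμ' : μ ∈ gradedExponents l := (MvPolynomial.mem_restrictSupport_iff ℝ).1 hQ hμ
  obtain ⟨h1, h2, -, -⟩ := symbolMarks_bounds hμ'
  have hm := finMarks_orders hμ'.2.1
  have he : excess (finMarks (orders l μ) 0) ≤ l := by
    rw [hm, excess_add]
    have : excess (Multiset.replicate (l - (Finsupp.toMultiset μ).card) (0, 0)) = 0 := by
      simp [excess]
    omega
  rw [excess_finMarks] at he
  have key := mixedPartial_eq_of_hasDerivAt (isLowerSet_sum_sub_two_le l)
    (G := fun β x => gaussLim (ofMarks h) 1 (finMarks β x))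
    (fun β i hβ x => hasDerivAt_gaussLim_finMarks hF hB 1 hl β i hβ x) he
  rw [gaussEval_monomial, Real.sqrt_one, points_zero, add_zero,
    ← gaussLim_replicate_zero hF 1 (l - (Finsupp.toMultiset μ).card) _ (by omega) (by omega), ← hm]
  congr 1
  exact congrFun key 0

end

end SymmExpansion

/-! ### The asymptotic expansion -/

theorem theorem2p2 (s : ℕ) (hs : 3 ≤ s) :
    ∃ c : ℝ, 0 < c ∧
      ∀ (h : (n : ℕ) → (Fin n → ℝ) → ℝ) (B : ℝ), 0 < B →
        SymmExpansion.Consistent h →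
        SymmExpansion.VanishingDeriv h →
        SymmExpansion.Symmetric h →
        (∀ n, 1 ≤ n →
          SymmExpansion.HasMixedPartials (SymmExpansion.belowAdmissible s n) (h n)) →
        (∀ n, 1 ≤ n → ∀ α : Fin n → ℕ, SymmExpansion.Admissible s α →
          ∀ ε : Fin n → ℝ, |SymmExpansion.mixedPartial α (h n) ε| ≤ B) →
        ∃ hInf : (l : ℕ) → (Fin l → ℝ) → ℝ → ℝ,
          SymmExpansion.IsLimitFunction h hInf ∧
          (∀ l ∈ Finset.Icc 1 (s - 3),
            SymmExpansion.HasMixedPartials {β : Fin l → ℕ | ∑ i, (β i - 2) ≤ l}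
              (fun lam => hInf l lam 1)) ∧
          ∀ (n : ℕ) (ε : Fin n → ℝ), ∑ i, ε i ^ 2 = 1 →
            |h n ε - (hInf 0 ![] 1 +
                ∑ l ∈ Finset.Icc 1 (s - 3),
                  SymmExpansion.applyAtZero
                    (SymmExpansion.edgeworth l (fun d => ∑ i, ε i ^ d))
                    (fun lam : Fin l → ℝ => hInf l lam 1))|
              ≤ c * B * ∑ i, |ε i| ^ s := by
  obtain ⟨C, hC, hexp⟩ := SymmExpansion.exists_expansion_bound (s - 2) (by omega)
  -- `C` is only known to be nonnegative.
  refine ⟨C + 1, by positivity, ?_⟩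
  intro h B hB hcons hvan hsymm hpart hbound
  have hF := SymmExpansion.markedFamily_ofMarks hcons hvan hsymm hpart hbound
  refine ⟨SymmExpansion.limitFunction h,
    SymmExpansion.isLimitFunction_limitFunction hs hB.le hcons hsymm hpart hF, ?_, ?_⟩
  · intro l hl
    rw [Finset.mem_Icc] at hl
    exact SymmExpansion.hasMixedPartials_of_hasDerivAt (SymmExpansion.isLowerSet_sum_sub_two_le l)
      (G := fun β x => SymmExpansion.gaussLim (SymmExpansion.ofMarks h) 1 (SymmExpansion.finMarks β x))
      (fun β i hβ x =>
        SymmExpansion.hasDerivAt_gaussLim_finMarks hF hB.le 1 (by omega) β i hβ x)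
  · intro n ε hε
    -- For `n = 0` the sum of squares is empty, hence not one.
    have hn : 1 ≤ n := by
      rcases Nat.eq_zero_or_pos n with rfl | hn
      · simp at hε
      · exact hn
    set U : Multiset ℝ := Finset.univ.val.map ε with hU
    have hsum : ∀ f : ℝ → ℝ, (U.map f).sum = ∑ i, f (ε i) := by
      intro f
      rw [hU, Multiset.map_map]
      rfl
    have key := hexp hF hB.le (a := 0) (by omega) U (by rw [hsum, hε]) U le_rfl 0
      SymmExpansion.zero_mem_gradedExponents
    rw [hsum, hsum, hε, sub_self, show s - 2 + 2 = s by omega] at key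
    have e1 : SymmExpansion.gaussEval (SymmExpansion.ofMarks h) 0 U
        (MvPolynomial.monomial 0 1) = h n ε := by
      rw [SymmExpansion.gaussEval_monomial, Real.sqrt_zero, SymmExpansion.symbolMarks_zero, zero_add,
        hF.gaussLim_zero _ (by simp) (by simp),
        ← SymmExpansion.ofMarks_finMarks_zero hcons hsymm hpart hn ε]
      congr 1
      rw [hU, SymmExpansion.points, Multiset.map_map]
      rfl
    have e2 : SymmExpansion.gaussEval (SymmExpansion.ofMarks h) 1 0
        (MvPolynomial.monomial 0 1 * SymmExpansion.edgeworthSum (s - 2) U) =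
        SymmExpansion.limitFunction h 0 ![] 1 + ∑ l ∈ Finset.Icc 1 (s - 3),
          SymmExpansion.applyAtZero (SymmExpansion.edgeworth l (fun d => ∑ i, ε i ^ d))
            (fun lam : Fin l → ℝ => SymmExpansion.limitFunction h l lam 1) := by
      rw [show (MvPolynomial.monomial 0 1 : SymmExpansion.DiffSymbols) = 1 from rfl, one_mul,
        SymmExpansion.edgeworthSum, Finset.range_eq_Ico, Finset.sum_eq_sum_Ico_succ_bot (by omega),
        SymmExpansion.coeff_zero_edgeworthSeries, map_add, map_sum,
        show Finset.Ico (0 + 1) (s - 2) = Finset.Icc 1 (s - 3) by ext; simp; omega]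
      congr 1
      · rw [show (1 : SymmExpansion.DiffSymbols) = MvPolynomial.monomial 0 1 from rfl,
          SymmExpansion.gaussEval_monomial, Real.sqrt_one]
        simp [SymmExpansion.limitFunction, SymmExpansion.finMarks]
      · refine Finset.sum_congr rfl fun l hl => ?_
        rw [Finset.mem_Icc] at hl
        rw [SymmExpansion.coeff_edgeworthSeries _ hl.1,
          SymmExpansion.applyAtZero_limitFunction hB.le hF (by omega)
            (SymmExpansion.edgeworth_mem _ hl.1)]
        simp only [hsum]
    rw [e1, e2] at key
    refine key.trans ?_
    have h0 : 0 ≤ ∑ i, |ε i| ^ s := Finset.sum_nonneg fun i _ => by positivity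
    have : C * B ≤ (C + 1) * B := by nlinarith
    exact mul_le_mul_of_nonneg_right this h0
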